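/- Let $\Gamma=\langle a,b\rangle$ be the free group of rank two, the fundamental group of the once-punctured torus $\mathbb T$, with peripheral element $[a,b]=aba^{-1}b^{-1}$. Let $\mathcal{MCG}\cong \mathrm{SL}(2,\mathbf Z)$ be the mapping class group of $\mathbb T$, that is, the group of those automorphisms of $\Gamma$ that send $[a,b]$ to a conjugate of itself, modulo inner automorphisms. Let $\hat\Omega$ be the set of free homotopy classes of unoriented non-trivial, non-peripheral simple closed curves on $\mathbb T$, that is, the set of classes $[g]$ of primitive elements $g\in\Gamma$ (members of a pair of free generators), where $[g]=[h]$ if and only if $g$ is conjugate to $h$ or $h^{-1}$. Let $\tau\in\mathbf C$ with $\tau\neq 2$. Let $\mathcal X_\tau$ be the set of homomorphisms $\rho:\Gamma\to \mathrm{SL}(2,\mathbf C)$ with $\mathrm{tr}\,\rho([a,b])=\tau$, modulo conjugation in $\mathrm{SL}(2,\mathbf C)$. It has the topology of the relative character variety $\{(x,y,z)\in\mathbf C^3 : x^2+y^2+z^2-xyz=\tau+2\}$, through the identification $[\rho]\mapsto(\mathrm{tr}\,\rho(a),\mathrm{tr}\,\rho(b),\mathrm{tr}\,\rho(ab))$.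 The group $\mathcal{MCG}$ acts on $\mathcal X_\tau$ by $[\varphi]\cdot[\rho]=[\rho\circ\varphi^{-1}]$. Let $(\mathcal X_\tau)_Q\subset\mathcal X_\tau$ be the $\mathcal{MCG}$-invariant subspace of the classes $[\rho]$ which satisfy the BQ-conditions: (BQ1) $\mathrm{tr}\,\rho(g)\notin[-2,2]$ for all $[g]\in\hat\Omega$; (BQ2) $|\mathrm{tr}\,\rho(g)|\le 2$ for only finitely many (possibly no) $[g]\in\hat\Omega$. **Theorem.** $\mathcal{MCG}$ acts properly discontinuously on $(\mathcal X_\tau)_Q$: for all compact subsets $K,L$ of $(\mathcal X_\tau)_Q$, the set $\{H\in\mathcal{MCG} : HK\cap L\neq\emptyset\}$ is finite. -/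

import Mathlib

namespace PuncturedTorus

/-- The fundamental group of the once-punctured torus: the free group on two generators. -/
abbrev Γ : Type := FreeGroup (Fin 2)

/-- The first free generator. -/
def a : Γ := FreeGroup.of 0

/-- The second free generator. -/
def b : Γ := FreeGroup.of 1

/-- The peripheral element `[a,b] = a b a⁻¹ b⁻¹`, represented by a loop around the puncture. -/
def peripheral : Γ := a * b * a⁻¹ * b⁻¹

/-- The group of complex two by two matrices of determinant one. -/
abbrev SL2C : Type := Matrix.SpecialLinearGroup (Fin 2) ℂ

/-- The trace of `ρ g`. -/
def tr (ρ : Γ →* SL2C) (g : Γ) : ℂ := Matrix.trace (ρ g : Matrix (Fin 2) (Fin 2) ℂ)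

/-! ### Simple closed curves -/

/-- `g` and `h` define the same free homotopy class of unoriented closed curves:
`g` is conjugate to `h` or to `h⁻¹`. -/
def curveSetoid : Setoid Γ where
  r g h := IsConj g h ∨ IsConj g h⁻¹
  iseqv := by
    have inv : ∀ {x y : Γ}, IsConj x y → IsConj x⁻¹ y⁻¹ := by
      intro x y h
      obtain ⟨c, hc⟩ := isConj_iff.1 h
      exact isConj_iff.2 ⟨c, by rw [← hc]; group⟩
    refine ⟨fun g => Or.inl (IsConj.refl g), ?_, ?_⟩
    · rintro g h (H | H)
      · exact Or.inl H.symm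
      · exact Or.inr (by simpa using (inv H).symm)
    · rintro g h k (H | H) (K | K)
      · exact Or.inl (H.trans K)
      · exact Or.inr (H.trans K)
      · exact Or.inr (H.trans (inv K))
      · exact Or.inl (H.trans (by simpa using inv K))

/-- Free homotopy classes of unoriented closed curves on the once-punctured torus. -/
def Curve : Type := Quotient curveSetoid

/-- The class of the closed curves represented by an element of `Γ`. -/
def Curve.mk (g : Γ) : Curve := Quotient.mk curveSetoid g

/-- `g` is primitive, i.e. it belongs to a pair of free generators of `Γ`. On the once-punctured
torus these are the elements which represent non-trivial, non-peripheral simple closed curves. -/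
def IsPrimitive (g : Γ) : Prop := ∃ σ : MulAut Γ, σ a = g

/-- The set of free homotopy classes of unoriented non-trivial, non-peripheral simple closed
curves on the once-punctured torus. -/
def simpleCurves : Set Curve := Curve.mk '' {g | IsPrimitive g}

/-! ### The mapping class group -/

/-- The automorphisms of `Γ` induced by orientation-preserving diffeomorphisms of the
once-punctured torus fixing the puncture: those that
preserve the conjugacy class of the (oriented) loop around the puncture. -/
def puncturedAut : Subgroup (MulAut Γ) where
  carrier := {φ | IsConj (φ peripheral) peripheral}
  one_mem' := IsConj.refl _
  mul_mem' := by
    intro φ ψ hφ hψ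
    exact ((φ : Γ ≃* Γ).toMonoidHom.map_isConj hψ).trans hφ
  inv_mem' := by
    intro φ hφ
    have h := (φ⁻¹ : MulAut Γ).toMonoidHom.map_isConj hφ
    have e : (φ⁻¹ : MulAut Γ).toMonoidHom (φ peripheral) = peripheral := by simp
    rw [e] at h
    exact h.symm

/-- The inner automorphisms of `Γ`, as a subgroup of `puncturedAut`. -/
def inner : Subgroup puncturedAut := (MulAut.conj : Γ →* MulAut Γ).range.subgroupOf puncturedAut

instance inner_normal : inner.Normal where
  conj_mem := by
    rintro ⟨n, hn⟩ hn' ⟨g, hg⟩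
    obtain ⟨c, hc⟩ := Subgroup.mem_subgroupOf.1 hn'
    refine Subgroup.mem_subgroupOf.2 ⟨g c, ?_⟩
    have hc' : MulAut.conj c = n := hc
    subst hc'
    ext1 x
    simp [MulAut.conj_apply]

/-- The mapping class group of the once-punctured torus, as the group of outer automorphisms of
its fundamental group which preserve the conjugacy class of the loop around the puncture. -/
abbrev MCG : Type := puncturedAut ⧸ inner

/-! ### The relative character variety -/

/-- The `τ`-representations: `tr ρ([a,b]) = τ`. -/
def TauRep (τ : ℂ) : Type := {ρ : Γ →* SL2C // tr ρ peripheral = τ}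

/-- Two `τ`-representations are equivalent if they are conjugate in `SL(2,ℂ)`. -/
def conjSetoid (τ : ℂ) : Setoid (TauRep τ) where
  r ρ ρ' := ∃ P : SL2C, ∀ g, ρ'.1 g = P * ρ.1 g * P⁻¹
  iseqv := by
    refine ⟨fun ρ => ⟨1, fun g => by simp⟩, ?_, ?_⟩
    · rintro ρ ρ' ⟨P, h⟩
      exact ⟨P⁻¹, fun g => by rw [h g]; group⟩
    · rintro ρ ρ' ρ'' ⟨P, h⟩ ⟨Q, k⟩
      exact ⟨Q * P, fun g => by rw [k g, h g]; group⟩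

/-- The space `𝒳_τ` of `τ`-representations modulo conjugation. -/
def X (τ : ℂ) : Type := Quotient (conjSetoid τ)

/-- The conjugacy class of a `τ`-representation. -/
def X.mk {τ : ℂ} (ρ : TauRep τ) : X τ := Quotient.mk (conjSetoid τ) ρ

theorem tr_isConj (ρ : Γ →* SL2C) {g h : Γ} (H : IsConj g h) : tr ρ g = tr ρ h := by
  obtain ⟨c, rfl⟩ := isConj_iff.1 H
  simp only [tr, map_mul, Matrix.SpecialLinearGroup.coe_mul]
  rw [Matrix.trace_mul_comm, ← Matrix.mul_assoc, ← Matrix.SpecialLinearGroup.coe_mul, ← map_mul]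
  simp

theorem tr_conj {ρ ρ' : Γ →* SL2C} {P : SL2C} (h : ∀ g, ρ' g = P * ρ g * P⁻¹) (g : Γ) :
    tr ρ' g = tr ρ g := by
  simp only [tr, h, Matrix.SpecialLinearGroup.coe_mul]
  rw [Matrix.trace_mul_comm, ← Matrix.mul_assoc, ← Matrix.SpecialLinearGroup.coe_mul]
  simp

/-- The trace coordinates `(x,y,z) = (tr ρ(a), tr ρ(b), tr ρ(ab))` of a class of
representations. For `τ ≠ 2` they identify `𝒳_τ` with the surface
`x² + y² + z² - xyz = τ + 2` in `ℂ³`. -/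
def traceCoords (τ : ℂ) : X τ → ℂ × ℂ × ℂ :=
  Quotient.lift (fun ρ : TauRep τ => (tr ρ.1 a, tr ρ.1 b, tr ρ.1 (a * b))) (by
    rintro ρ ρ' ⟨P, h⟩
    simp only [tr_conj h])

/-- The topology of the relative character variety, as a subset of `ℂ³` by the trace
coordinates. -/
noncomputable instance (τ : ℂ) : TopologicalSpace (X τ) :=
  TopologicalSpace.induced (traceCoords τ) inferInstance

/-! ### The action of the mapping class group -/

/-- The `τ`-representation `ρ ∘ φ⁻¹`. -/
def TauRep.act {τ : ℂ} (φ : puncturedAut) (ρ : TauRep τ) : TauRep τ :=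
  ⟨ρ.1.comp (φ⁻¹ : puncturedAut).1.toMonoidHom,
    (tr_isConj ρ.1 (φ⁻¹ : puncturedAut).2).trans ρ.2⟩

@[simp] theorem TauRep.act_apply {τ : ℂ} (φ : puncturedAut) (ρ : TauRep τ) (g : Γ) :
    (TauRep.act φ ρ).1 g = ρ.1 ((φ⁻¹ : puncturedAut).1 g) := rfl

/-- The map `[ρ] ↦ [ρ ∘ φ⁻¹]` on `𝒳_τ`. -/
def X.act {τ : ℂ} (φ : puncturedAut) : X τ → X τ :=
  Quotient.map (TauRep.act φ) (by
    rintro ρ ρ' ⟨P, h⟩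
    exact ⟨P, fun g => h _⟩)

/-- The maps `[ρ] ↦ [ρ ∘ φ⁻¹]` form an action of `puncturedAut` on `𝒳_τ`. -/
abbrev autAction (τ : ℂ) : MulAction puncturedAut (X τ) where
  smul φ x := X.act φ x
  one_smul x := by
    induction x using Quotient.inductionOn with
    | h ρ =>
      refine congrArg (Quotient.mk (conjSetoid τ)) (Subtype.ext (MonoidHom.ext fun g => ?_))
      simp
  mul_smul φ ψ x := by
    induction x using Quotient.inductionOn with
    | h ρ =>
      refine congrArg (Quotient.mk (conjSetoid τ)) (Subtype.ext (MonoidHom.ext fun g => ?_))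
      simp

theorem X.act_inner {τ : ℂ} {φ : puncturedAut} (hφ : φ ∈ inner) (x : X τ) : X.act φ x = x := by
  induction x using Quotient.inductionOn with
  | h ρ =>
    obtain ⟨c, hc⟩ := Subgroup.mem_subgroupOf.1 hφ
    have hc' : MulAut.conj c = φ.1 := hc
    refine Quotient.sound (s := conjSetoid τ) ⟨ρ.1 c, fun g => ?_⟩
    simp [← hc', mul_assoc]

/-- The induced homomorphism from the mapping class group to the permutations of `𝒳_τ`. -/
def mcgPerm (τ : ℂ) : MCG →* Equiv.Perm (X τ) :=
  QuotientGroup.lift inner (@MulAction.toPermHom puncturedAut (X τ) _ (autAction τ)) (by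
    intro φ hφ
    exact Equiv.ext fun x => X.act_inner hφ x)

/-- The mapping class group acts on `𝒳_τ` by `[φ] • [ρ] = [ρ ∘ φ⁻¹]`. -/
noncomputable instance (τ : ℂ) : MulAction MCG (X τ) := MulAction.compHom (X τ) (mcgPerm τ)

theorem smul_mk {τ : ℂ} (φ : puncturedAut) (ρ : TauRep τ) :
    (QuotientGroup.mk φ : MCG) • X.mk ρ = X.mk (TauRep.act φ ρ) := rfl

/-! ### Bowditch representations -/

/-- The BQ-conditions for a representation `ρ`. -/
structure IsBQ (ρ : Γ →* SL2C) : Prop where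
  /-- `tr ρ(g) ∉ [-2,2]` for every class `[g]` of simple closed curves. -/
  bq1 : ∀ g, Curve.mk g ∈ simpleCurves → tr ρ g ∉ ((↑) : ℝ → ℂ) '' Set.Icc (-2) 2
  /-- `|tr ρ(g)| ≤ 2` for only finitely many classes `[g]` of simple closed curves. -/
  bq2 : {c ∈ simpleCurves | ∃ g, Curve.mk g = c ∧ ‖tr ρ g‖ ≤ 2}.Finite

theorem IsBQ.of_conj {ρ ρ' : Γ →* SL2C} {P : SL2C} (h : ∀ g, ρ' g = P * ρ g * P⁻¹)
    (H : IsBQ ρ) : IsBQ ρ' := by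
  refine ⟨fun g hg => ?_, ?_⟩
  · rw [tr_conj h]; exact H.bq1 g hg
  · simp only [tr_conj h]; exact H.bq2

/-- Automorphisms of `Γ` act on the classes of closed curves. -/
def Curve.map (σ : MulAut Γ) : Curve → Curve :=
  Quotient.map σ (by
    rintro g h (H | H)
    · exact Or.inl (σ.toMonoidHom.map_isConj H)
    · exact Or.inr (by simpa using σ.toMonoidHom.map_isConj H))

theorem Curve.map_mem (σ : MulAut Γ) {c : Curve} (hc : c ∈ simpleCurves) :
    Curve.map σ c ∈ simpleCurves := by
  obtain ⟨g, ⟨θ, rfl⟩, rfl⟩ := hc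
  exact ⟨σ (θ a), ⟨σ * θ, rfl⟩, rfl⟩

theorem Curve.map_injective (σ : MulAut Γ) : Function.Injective (Curve.map σ) := by
  refine Function.LeftInverse.injective (g := Curve.map σ⁻¹) fun c => ?_
  induction c using Quotient.inductionOn with
  | h g => exact congrArg Curve.mk (by simp)

theorem IsBQ.comp {ρ : Γ →* SL2C} (H : IsBQ ρ) (σ : MulAut Γ) :
    IsBQ (ρ.comp σ.toMonoidHom) := by
  refine ⟨fun g hg => H.bq1 (σ g) (Curve.map_mem σ hg), ?_⟩
  refine Set.Finite.of_finite_image (f := Curve.map σ) (H.bq2.subset ?_)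
    (Curve.map_injective σ).injOn
  rintro _ ⟨c, ⟨hc, g, rfl, hg⟩, rfl⟩
  exact ⟨Curve.map_mem σ hc, σ g, rfl, hg⟩

/-- The Bowditch representation space `(𝒳_τ)_Q`: the classes of the `τ`-representations which
satisfy the BQ-conditions. -/
def XQ (τ : ℂ) : Set (X τ) :=
  {x | Quotient.liftOn x (fun ρ : TauRep τ => IsBQ ρ.1) (by
    rintro ρ ρ' h
    refine propext ⟨?_, ?_⟩
    · obtain ⟨P, h⟩ := h
      exact IsBQ.of_conj h
    · obtain ⟨P, h⟩ := (conjSetoid τ).symm h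
      exact IsBQ.of_conj h)}

theorem smul_mem_XQ {τ : ℂ} (H : MCG) {x : X τ} (hx : x ∈ XQ τ) : H • x ∈ XQ τ := by
  induction H using QuotientGroup.induction_on with
  | H φ =>
    induction x using Quotient.inductionOn with
    | h ρ =>
      have h : IsBQ ρ.1 := hx
      exact h.comp (φ⁻¹ : puncturedAut).1

/-- The mapping class group acts on `(𝒳_τ)_Q` by restriction. -/
noncomputable instance (τ : ℂ) : MulAction MCG (XQ τ) where
  smul H x := ⟨H • x.1, smul_mem_XQ H x.2⟩
  one_smul x := Subtype.ext (one_smul MCG x.1)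
  mul_smul H K x := Subtype.ext (mul_smul H K x.1)

end PuncturedTorus

/-! Up to inner automorphisms, every automorphism of Γ is a vertex of the trivalent tree of
superbases times an element of a finite group (`exists_vertexAut`, `finite_superbaseSymm`); this
rests on Nielsen's theorem `eq_top_of_generators_mem`. The finite group preserves `height`, the
largest modulus of the three traces of a superbase (`height_comp_of_mem`). If H carries a point of K
into L, the vertex attached to H⁻¹ therefore has height at most a bound M for the trace coordinates
on L. So it is enough that, over a compact K, only finitely many vertices ever have height at most
M; by compactness this is a local question, answered by `BowditchPoint.escapes`.

The local statement is König's lemma: were it false, some infinite path would avoid all vertices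
beyond which the heights are locally uniformly large up to finitely many exceptions, and
`BowditchPoint.exists_escapes_of_path` forbids this. There are two kinds of path.

A path that eventually repeats one letter runs around a region of constant trace x = l + l⁻¹. The
neighbouring traces obey a linear recursion with eigenvalues l and l⁻¹. BQ1 gives |l| > 1, and x² ≠
μ (where μ = τ + 2) because otherwise the neighbours would decay in one direction, against BQ2.
Hence they grow, locally uniformly in the triple (`eventually_growth`).

On a path that uses both letters infinitely often, BQ2 makes all traces eventually larger than 2 in
modulus. If one move is ascending, all later ones are, on every branch, and the traces are unbounded
(`Ascending.exists_lt`). If none is, the moduli decrease to 2 and a limit triple satisfies μ = 4,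
that is τ = 2, which is excluded (`not_descending`). -/

open Filter Topology

namespace PuncturedTorus

/-! ### Dynamics of the elementary moves on trace coordinates -/

/-- The cubic whose level sets are the relative character varieties. -/
def markoff (p : ℂ × ℂ × ℂ) : ℂ := p.1 ^ 2 + p.2.1 ^ 2 + p.2.2 ^ 2 - p.1 * p.2.1 * p.2.2

/-- The effect on trace coordinates of the two changes of basis `(g, h) ↦ (g, g h)` (for `true`)
and `(g, h) ↦ (g h, h)` (for `false`). -/
def step (d : Bool) (p : ℂ × ℂ × ℂ) : ℂ × ℂ × ℂ :=
  if d then (p.1, p.2.2, p.1 * p.2.2 - p.2.1) else (p.2.2, p.2.1, p.2.2 * p.2.1 - p.1)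

/-- Exchange of the first two trace coordinates. -/
def swapCoords (p : ℂ × ℂ × ℂ) : ℂ × ℂ × ℂ := (p.2.1, p.1, p.2.2)

/-- The composite of the moves of a word, read from left to right. -/
def walk (w : List Bool) (p : ℂ × ℂ × ℂ) : ℂ × ℂ × ℂ := w.foldl (fun q d => step d q) p

/-- The largest modulus of a trace coordinate. -/
noncomputable def height (p : ℂ × ℂ × ℂ) : ℝ := max ‖p.1‖ (max ‖p.2.1‖ ‖p.2.2‖)

theorem markoff_step (d : Bool) (p : ℂ × ℂ × ℂ) : markoff (step d p) = markoff p := by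
  cases d <;> simp only [step, markoff, if_true, if_false, Bool.false_eq_true] <;> ring

theorem walk_append (v w : List Bool) (p : ℂ × ℂ × ℂ) : walk (v ++ w) p = walk w (walk v p) :=
  List.foldl_append

theorem walk_cons (d : Bool) (w : List Bool) (p : ℂ × ℂ × ℂ) :
    walk (d :: w) p = walk w (step d p) := rfl

@[simp] theorem walk_nil (p : ℂ × ℂ × ℂ) : walk [] p = p := rfl

theorem walk_concat (d : Bool) (w : List Bool) (p : ℂ × ℂ × ℂ) :
    walk (w ++ [d]) p = step d (walk w p) := walk_append _ _ _

theorem markoff_walk (w : List Bool) (p : ℂ × ℂ × ℂ) : markoff (walk w p) = markoff p := by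
  induction w generalizing p with
  | nil => rfl
  | cons d w ih => rw [walk_cons, ih, markoff_step]

theorem markoff_swapCoords (p : ℂ × ℂ × ℂ) : markoff (swapCoords p) = markoff p := by
  simp only [markoff, swapCoords]; ring

theorem step_swapCoords (d : Bool) (p : ℂ × ℂ × ℂ) : step d (swapCoords p) = swapCoords (step (!d) p) := by
  cases d <;> simp [step, swapCoords, mul_comm]

/-- This symmetry lets the analysis treat only the letter `true`. -/
theorem walk_swapCoords (w : List Bool) (p : ℂ × ℂ × ℂ) :
    walk w (swapCoords p) = swapCoords (walk (w.map not) p) := by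
  induction w generalizing p with
  | nil => rfl
  | cons d w ih => rw [walk_cons, step_swapCoords, ih]; rfl

theorem height_swapCoords (p : ℂ × ℂ × ℂ) : height (swapCoords p) = height p := max_left_comm _ _ _

theorem continuous_step (d : Bool) : Continuous (step d) := by
  cases d
  · exact (by fun_prop : Continuous fun p : ℂ × ℂ × ℂ => (p.2.2, p.2.1, p.2.2 * p.2.1 - p.1))
  · exact (by fun_prop : Continuous fun p : ℂ × ℂ × ℂ => (p.1, p.2.2, p.1 * p.2.2 - p.2.1))

theorem continuous_walk (w : List Bool) : Continuous (walk w) := by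
  induction w with
  | nil => exact continuous_id
  | cons d w ih => exact ih.comp (continuous_step d)

theorem continuous_swapCoords : Continuous swapCoords := by unfold swapCoords; fun_prop

/-! ### Growth around a region -/

/-- The interval `[-2,2]` of the real axis. -/
abbrev ellipticTraces : Set ℂ := ((↑) : ℝ → ℂ) '' Set.Icc (-2) 2

/-- The roots of t² - xt + 1 have product 1, so one of them has modulus at least 1. -/
theorem exists_add_inv (x : ℂ) : ∃ l : ℂ, l ≠ 0 ∧ x = l + l⁻¹ ∧ 1 ≤ ‖l‖ := by
  obtain ⟨s, hs⟩ := IsAlgClosed.exists_pow_nat_eq (x ^ 2 - 4) (n := 2) (by norm_num)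
  have key : ∀ t : ℂ, t ^ 2 = x ^ 2 - 4 → ((x + t) / 2) * ((x - t) / 2) = 1 := by
    intro t ht
    linear_combination (-1 / 4 : ℂ) * ht
  have h1 := key s hs
  have hx : ∀ l m : ℂ, l * m = 1 → x = l + m → 1 ≤ ‖l‖ → ∃ l : ℂ, l ≠ 0 ∧ x = l + l⁻¹ ∧ 1 ≤ ‖l‖ :=
    fun l m hlm hx hl => ⟨l, left_ne_zero_of_mul_eq_one hlm,
      by rw [hx, eq_inv_of_mul_eq_one_right hlm], hl⟩
  rcases le_total 1 ‖(x + s) / 2‖ with h | h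
  · exact hx _ _ h1 (by ring) h
  · refine hx ((x - s) / 2) ((x + s) / 2) (by rw [mul_comm]; exact h1) (by ring) ?_
    have h2 : ‖(x + s) / 2‖ * ‖(x - s) / 2‖ = 1 := by rw [← norm_mul, h1, norm_one]
    nlinarith [norm_nonneg ((x - s) / 2)]

/-- Since l + l⁻¹ ∓ 2 = (l ∓ 1)² / l, this is the parallelogram law for l and 1. It expresses the
size of the eigenvalue as a continuous function of the trace, with no choice of root, which gives
bounds uniform near a given trace. -/
theorem norm_add_inv_norm {l : ℂ} (hl : l ≠ 0) :
    ‖l‖ + ‖l‖⁻¹ = (‖l + l⁻¹ - 2‖ + ‖l + l⁻¹ + 2‖) / 2 := by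
  have e1 : l + l⁻¹ - 2 = (l - 1) ^ 2 * l⁻¹ := by field_simp; ring
  have e2 : l + l⁻¹ + 2 = (l + 1) ^ 2 * l⁻¹ := by field_simp; ring
  have hp := parallelogram_law_with_norm ℝ l 1
  have hn : ‖l‖ ≠ 0 := norm_ne_zero_iff.2 hl
  rw [e1, e2, norm_mul, norm_mul, norm_pow, norm_pow, norm_inv]
  rw [norm_one] at hp
  field_simp
  nlinarith

/-- If |l| = 1 then l⁻¹ is the conjugate of l and x = 2 Re l lies in [-2,2]; otherwise |l| + |l|⁻¹ >
2. -/
theorem two_lt_of_not_elliptic {x : ℂ} (hx : x ∉ ellipticTraces) : 2 < (‖x - 2‖ + ‖x + 2‖) / 2 := by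
  obtain ⟨l, hl, rfl, h1⟩ := exists_add_inv x
  rw [← norm_add_inv_norm hl]
  have hpos : 0 < ‖l‖ := by linarith
  rcases h1.eq_or_lt with h | h
  · exfalso
    apply hx
    have hi : l⁻¹ = (starRingEnd ℂ) l := by
      rw [Complex.inv_def, Complex.normSq_eq_norm_sq, ← h]; simp
    refine ⟨2 * l.re, ?_, ?_⟩
    · have := abs_le.1 (Complex.abs_re_le_norm l)
      constructor <;> linarith
    · rw [hi, Complex.add_conj]
  · have : ‖l‖ + ‖l‖⁻¹ - 2 = (‖l‖ - 1) ^ 2 * ‖l‖⁻¹ := by field_simp; ring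
    have h2 : 0 < (‖l‖ - 1) ^ 2 * ‖l‖⁻¹ := by
      have : 0 < ‖l‖ - 1 := by linarith
      positivity
    linarith

theorem walk_replicate_true_fst (n : ℕ) (p : ℂ × ℂ × ℂ) :
    (walk (List.replicate n true) p).1 = p.1 := by
  induction n generalizing p with
  | zero => rfl
  | succ n ih => rw [List.replicate_succ, walk_cons, ih]; rfl

/-- With x fixed the move is the linear map (y, z) ↦ (z, xz - y), and z - l⁻¹y is an eigenfunction
of it with eigenvalue l. -/
theorem walk_replicate_true_sub {l : ℂ} (hl : l ≠ 0) (n : ℕ) {p : ℂ × ℂ × ℂ} (hp : p.1 = l + l⁻¹) :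
    (walk (List.replicate n true) p).2.2 - l⁻¹ * (walk (List.replicate n true) p).2.1 =
      l ^ n * (p.2.2 - l⁻¹ * p.2.1) := by
  induction n generalizing p with
  | zero => simp
  | succ n ih =>
    rw [List.replicate_succ, walk_cons, ih (p := step true p) hp]
    simp only [step, if_true, hp]
    field_simp
    ring

theorem walk_replicate_true_mul {l : ℂ} (hl : l ≠ 0) (n : ℕ) {p : ℂ × ℂ × ℂ} (hp : p.1 = l + l⁻¹) :
    (walk (List.replicate n true) p).2.1 * (l - l⁻¹) =
      l ^ n * (p.2.2 - l⁻¹ * p.2.1) - l⁻¹ ^ n * (p.2.2 - l * p.2.1) := by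
  have h1 := walk_replicate_true_sub hl n hp
  have h2 := walk_replicate_true_sub (inv_ne_zero hl) n (p := p) (by rw [hp, inv_inv, add_comm])
  rw [inv_inv] at h2
  rw [← h1, ← h2]
  ring

/-- The quadratic form y² + z² - xyz splits into the two eigenfunctions. Hence both are nonzero
exactly when x² differs from the value of the cubic. -/
theorem sub_mul_sub_eq {l : ℂ} (hl : l ≠ 0) {p : ℂ × ℂ × ℂ} (hp : p.1 = l + l⁻¹) :
    (p.2.2 - l⁻¹ * p.2.1) * (p.2.2 - l * p.2.1) = markoff p - p.1 ^ 2 := by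
  have : l⁻¹ * l = 1 := inv_mul_cancel₀ hl
  simp only [markoff, hp]
  linear_combination (p.2.1 ^ 2) * this

/-- Uniform growth of the traces of the neighbours of a region which is neither elliptic nor
degenerate. -/
theorem eventually_growth {μ : ℂ} {p₀ : ℂ × ℂ × ℂ} (hx : p₀.1 ∉ ellipticTraces)
    (hμ : p₀.1 ^ 2 ≠ μ) (C : ℝ) :
    ∃ N, ∀ᶠ p in 𝓝 p₀, markoff p = μ → ∀ n, N ≤ n →
      C < ‖(walk (List.replicate n true) p).2.1‖ := by
  set s : ℂ → ℝ := fun x => (‖x - 2‖ + ‖x + 2‖) / 2 with hs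
  have hs0 : 2 < s p₀.1 := two_lt_of_not_elliptic hx
  set r : ℝ := s p₀.1 / 2 with hr
  have hr1 : 1 < r := by linarith
  set B : ℂ × ℂ × ℂ → ℝ := fun p => ‖p.2.2‖ + (‖p.1‖ + 1) * ‖p.2.1‖ with hB
  set C₀ : ℝ := B p₀ + 1 with hC₀
  have hC₀pos : 0 < C₀ := by simp only [hC₀, hB]; positivity
  set δ : ℝ := ‖μ - p₀.1 ^ 2‖ / 2 with hδ
  have hδ2 : 0 < ‖μ - p₀.1 ^ 2‖ := norm_pos_iff.2 (sub_ne_zero.2 hμ.symm)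
  have hδpos : 0 < δ := by linarith
  set D : ℝ := ‖p₀.1‖ + 3 with hD
  have hDpos : 0 < D := by positivity
  -- Near p₀ one has r ≤ |l|, |v| ≤ C₀, |u| ≥ δ / C₀ and |l - l⁻¹| ≤ D; this N makes the growing
  -- term lⁿu dominate.
  obtain ⟨N, hN⟩ := pow_unbounded_of_one_lt ((C * D + C₀) * (C₀ / δ)) hr1
  refine ⟨N, ?_⟩
  have c1 : ∀ᶠ p : ℂ × ℂ × ℂ in 𝓝 p₀, r + 1 < s p.1 :=
    (by fun_prop : Continuous fun p : ℂ × ℂ × ℂ => s p.1).continuousAt.eventually_const_lt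
      (by linarith)
  have c2 : ∀ᶠ p : ℂ × ℂ × ℂ in 𝓝 p₀, B p < C₀ :=
    (by fun_prop : Continuous B).continuousAt.eventually_lt_const (by linarith)
  have c3 : ∀ᶠ p : ℂ × ℂ × ℂ in 𝓝 p₀, δ < ‖μ - p.1 ^ 2‖ :=
    (by fun_prop : Continuous fun p : ℂ × ℂ × ℂ => ‖μ - p.1 ^ 2‖).continuousAt.eventually_const_lt
      (by linarith)
  have c4 : ∀ᶠ p : ℂ × ℂ × ℂ in 𝓝 p₀, ‖p.1‖ < ‖p₀.1‖ + 1 :=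
    (by fun_prop : Continuous fun p : ℂ × ℂ × ℂ => ‖p.1‖).continuousAt.eventually_lt_const
      (by linarith)
  filter_upwards [c1, c2, c3, c4] with p h1 h2 h3 h4 hp n hn
  obtain ⟨l, hl, hxl, hl1⟩ := exists_add_inv p.1
  have hlpos : 0 < ‖l‖ := by linarith
  have hinv : ‖l‖⁻¹ ≤ 1 := inv_le_one_of_one_le₀ hl1
  -- Here |l| + |l|⁻¹ > r + 1 while |l|⁻¹ ≤ 1.
  have hrl : r ≤ ‖l‖ := by
    have := norm_add_inv_norm hl
    rw [← hxl] at this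
    simp only [hs] at h1
    linarith
  have hlx : ‖l‖ ≤ ‖p.1‖ + 1 := by
    have : l = p.1 - l⁻¹ := by rw [hxl]; ring
    calc ‖l‖ = ‖p.1 - l⁻¹‖ := by rw [← this]
      _ ≤ ‖p.1‖ + ‖l⁻¹‖ := norm_sub_le _ _
      _ ≤ ‖p.1‖ + 1 := by rw [norm_inv]; linarith
  set u := p.2.2 - l⁻¹ * p.2.1 with hu
  set v := p.2.2 - l * p.2.1 with hv
  have hvC : ‖v‖ ≤ C₀ := by
    have : ‖v‖ ≤ ‖p.2.2‖ + ‖l‖ * ‖p.2.1‖ := by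
      rw [hv, ← norm_mul]; exact norm_sub_le _ _
    have h5 : ‖l‖ * ‖p.2.1‖ ≤ (‖p.1‖ + 1) * ‖p.2.1‖ := by gcongr
    simp only [hB] at h2
    linarith
  -- The product uv is μ - x², which stays away from 0, and v is bounded.
  have huδ : δ / C₀ ≤ ‖u‖ := by
    rw [div_le_iff₀ hC₀pos]
    have e := sub_mul_sub_eq hl hxl
    rw [hp] at e
    have e2 : ‖u‖ * ‖v‖ = ‖μ - p.1 ^ 2‖ := by rw [← norm_mul, e]
    nlinarith [norm_nonneg u]
  have hmul := walk_replicate_true_mul hl n hxl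
  set y := (walk (List.replicate n true) p).2.1
  have hrn : r ^ N ≤ ‖l‖ ^ n :=
    (pow_le_pow_right₀ hr1.le hn).trans (pow_le_pow_left₀ (by linarith) hrl n)
  have hlow : ‖l‖ ^ n * ‖u‖ - ‖l‖⁻¹ ^ n * ‖v‖ ≤ ‖y‖ * ‖l - l⁻¹‖ := by
    rw [← norm_mul, hmul, ← norm_inv, ← norm_pow, ← norm_pow, ← norm_mul, ← norm_mul]
    exact norm_sub_norm_le _ _
  have hb : ‖l - l⁻¹‖ ≤ D := by
    have := norm_sub_le l l⁻¹
    rw [norm_inv] at this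
    linarith
  have hb2 : ‖l‖⁻¹ ^ n * ‖v‖ ≤ C₀ := by
    have : ‖l‖⁻¹ ^ n ≤ 1 := pow_le_one₀ (by positivity) hinv
    nlinarith [norm_nonneg v]
  have hb3 : C * D + C₀ < ‖l‖ ^ n * ‖u‖ := by
    have e1 : (C * D + C₀) * (C₀ / δ) * (δ / C₀) = C * D + C₀ := by field_simp
    calc C * D + C₀ = (C * D + C₀) * (C₀ / δ) * (δ / C₀) := e1.symm
      _ < r ^ N * (δ / C₀) := by gcongr
      _ ≤ ‖l‖ ^ n * ‖u‖ := by gcongr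
  have hb4 : ‖y‖ * ‖l - l⁻¹‖ ≤ ‖y‖ * D := by gcongr
  have : C * D < ‖y‖ * D := by linarith
  exact lt_of_mul_lt_mul_right this hDpos.le

/-- If `x² = μ` then the traces of the neighbours of the region decay in one of the two
directions. -/
theorem tendsto_zero_of_sq_eq {p : ℂ × ℂ × ℂ} (hx : p.1 ∉ ellipticTraces)
    (hμ : p.1 ^ 2 = markoff p) :
    Tendsto (fun n => (walk (List.replicate n true) p).2.1) atTop (𝓝 0) ∨
    Tendsto (fun n => (walk (List.replicate n true) (p.1, p.2.1, p.1 * p.2.1 - p.2.2)).2.1)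
      atTop (𝓝 0) := by
  obtain ⟨l, hl, hxl, hl1⟩ := exists_add_inv p.1
  have hlt : 1 < ‖l‖ := by
    refine lt_of_le_of_ne hl1 fun h => ?_
    have h1 := two_lt_of_not_elliptic hx
    rw [hxl, ← norm_add_inv_norm hl, ← h] at h1
    norm_num at h1
  have hlinv : l - l⁻¹ ≠ 0 := by
    intro h
    have : l = l⁻¹ := sub_eq_zero.1 h
    have h2 : ‖l‖ = ‖l‖⁻¹ := by rw [← norm_inv, ← this]
    have h3 : ‖l‖⁻¹ < 1 := inv_lt_one_of_one_lt₀ hlt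
    linarith
  have hlim : Tendsto (fun n : ℕ => l⁻¹ ^ n) atTop (𝓝 0) :=
    tendsto_pow_atTop_nhds_zero_of_norm_lt_one (by rw [norm_inv]; exact inv_lt_one_of_one_lt₀ hlt)
  have main : ∀ q : ℂ × ℂ × ℂ, q.1 = l + l⁻¹ → q.2.2 - l⁻¹ * q.2.1 = 0 →
      Tendsto (fun n => (walk (List.replicate n true) q).2.1) atTop (𝓝 0) := by
    intro q hq h0
    have e : (fun n => (walk (List.replicate n true) q).2.1) =
        fun n => l⁻¹ ^ n * (-(q.2.2 - l * q.2.1) / (l - l⁻¹)) := by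
      funext n
      have := walk_replicate_true_mul hl n hq
      rw [h0, mul_zero, zero_sub] at this
      rw [← mul_div_assoc, eq_div_iff hlinv, this]
      ring
    rw [e]
    simpa using hlim.mul_const (-(q.2.2 - l * q.2.1) / (l - l⁻¹))
  have h := sub_mul_sub_eq hl hxl
  rw [hμ, sub_self] at h
  rcases mul_eq_zero.1 h with h | h
  · exact Or.inl (main p hxl h)
  -- Now z = ly, so the flipped coordinate xy - z equals l⁻¹y and the flipped triple decays.
  · refine Or.inr (main _ hxl ?_)
    simp only [hxl]
    linear_combination -h

/-! ### Infinite paths in the tree -/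

/-- The last move increased the modulus of the new coordinate, away from small traces. -/
def Ascending (p : ℂ × ℂ × ℂ) : Prop :=
  2 < ‖p.1‖ ∧ 2 < ‖p.2.1‖ ∧ ‖p.1 * p.2.1 - p.2.2‖ < ‖p.2.2‖

theorem Ascending.norm_mul_lt {p : ℂ × ℂ × ℂ} (h : Ascending p) :
    ‖p.1‖ * ‖p.2.1‖ < 2 * ‖p.2.2‖ := by
  have e : ‖p.1 * p.2.1‖ ≤ ‖p.1 * p.2.1 - p.2.2‖ + ‖p.2.2‖ := by
    simpa using norm_add_le (p.1 * p.2.1 - p.2.2) p.2.2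
  rw [norm_mul] at e
  linarith [h.2.2]

theorem Ascending.swapCoords {p : ℂ × ℂ × ℂ} (h : Ascending p) : Ascending (swapCoords p) :=
  ⟨h.2.1, h.1, by simpa [PuncturedTorus.swapCoords, mul_comm] using h.2.2⟩

/-- From |x||y| < 2|z| and |x| > 2 follows |y| < |z|, so |xz - y| ≥ |x||z| - |y| > 2|z| - |y| > |y|.
The other letter follows by exchanging coordinates. -/
theorem Ascending.step {p : ℂ × ℂ × ℂ} (h : Ascending p) (d : Bool) : Ascending (step d p) := by
  have key : ∀ q, Ascending q → Ascending (PuncturedTorus.step true q) := by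
    intro q hq
    have h1 := hq.norm_mul_lt
    obtain ⟨h2, h3, h4⟩ := hq
    refine ⟨h2, ?_, ?_⟩
    · change 2 < ‖q.2.2‖
      nlinarith
    · change ‖q.1 * q.2.2 - (q.1 * q.2.2 - q.2.1)‖ < ‖q.1 * q.2.2 - q.2.1‖
      have e := norm_sub_norm_le (q.1 * q.2.2) q.2.1
      rw [norm_mul] at e
      rw [sub_sub_cancel]
      have h5 : ‖q.2.1‖ < ‖q.2.2‖ := by nlinarith
      have h6 : 2 * ‖q.2.2‖ < ‖q.1‖ * ‖q.2.2‖ := by gcongr; linarith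
      linarith
  cases d with
  | true => exact key p h
  | false =>
    have := (key _ h.swapCoords).swapCoords
    rwa [step_swapCoords] at this

theorem Ascending.walk {p : ℂ × ℂ × ℂ} (h : Ascending p) (w : List Bool) : Ascending (walk w p) := by
  induction w generalizing p with
  | nil => exact h
  | cons d w ih => exact ih (h.step d)

/-- The new coordinate z is larger in modulus than both x and y, so one of the two coordinates kept
by any move is still above M. -/
theorem Ascending.lt_height {p : ℂ × ℂ × ℂ} (h : Ascending p) {M : ℝ}
    (hM : M < ‖p.1‖ ∨ M < ‖p.2.1‖) (w : List Bool) : M < height (PuncturedTorus.walk w p) := by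
  induction w generalizing p with
  | nil => rcases hM with hM | hM <;> simp [height, hM]
  | cons d w ih =>
    have h1 := h.norm_mul_lt
    have hz : M < ‖p.2.2‖ := by
      obtain ⟨h2, h3, -⟩ := h
      rcases hM with hM | hM <;> nlinarith
    refine ih (h.step d) ?_
    cases d
    · exact Or.inl hz
    · exact Or.inr hz

/-- Along an ascending path the traces are unbounded. -/
theorem Ascending.exists_lt {p : ℕ → ℂ × ℂ × ℂ} {d : ℕ → Bool}
    (hstep : ∀ i, p (i + 1) = PuncturedTorus.step (d i) (p i)) (h : Ascending (p 0)) (M : ℝ) :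
    ∃ i, Ascending (p i) ∧ (M < ‖(p i).1‖ ∨ M < ‖(p i).2.1‖) := by
  have hasc : ∀ i, Ascending (p i) := by
    intro i
    induction i with
    | zero => exact h
    | succ i ih => rw [hstep]; exact ih.step _
  set m : ℝ := min ‖(p 0).1‖ ‖(p 0).2.1‖ with hm
  have hm2 : 2 < m := lt_min h.1 h.2.1
  have hmin : ∀ i, m ≤ ‖(p i).1‖ ∧ m ≤ ‖(p i).2.1‖ := by
    intro i
    induction i with
    | zero => exact ⟨min_le_left _ _, min_le_right _ _⟩
    | succ i ih =>
      have h1 := (hasc i).norm_mul_lt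
      have hz : m ≤ ‖(p i).2.2‖ := by nlinarith
      rw [hstep]
      cases d i
      · exact ⟨hz, ih.2⟩
      · exact ⟨ih.1, hz⟩
  -- Each new z exceeds |x||y| / 2, where one factor is at least (m/2)^i and the other at least m.
  have hgrow : ∀ i : ℕ, (m / 2) ^ i ≤ ‖(p i).1‖ ∨ (m / 2) ^ i ≤ ‖(p i).2.1‖ := by
    intro i
    induction i with
    | zero => left; linarith [h.1, pow_zero (m / 2)]
    | succ i ih =>
      have h1 := (hasc i).norm_mul_lt
      obtain ⟨h2, h3⟩ := hmin i
      have hz : (m / 2) ^ (i + 1) ≤ ‖(p i).2.2‖ := by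
        rw [pow_succ]
        have : 0 < (m / 2) ^ i := by positivity
        rcases ih with ih | ih
        · nlinarith [mul_le_mul ih h3 (by linarith) (by positivity)]
        · nlinarith [mul_le_mul ih h2 (by linarith) (by positivity)]
      rw [hstep]
      cases d i
      · exact Or.inl hz
      · exact Or.inr hz
  obtain ⟨i, hi⟩ := pow_unbounded_of_one_lt M (show 1 < m / 2 by linarith)
  exact ⟨i, hasc i, (hgrow i).imp hi.trans_le hi.trans_le⟩

/-- If two numbers of the same modulus add up to twice this modulus, they agree. -/
theorem eq_of_norm_add {z w : ℂ} {r : ℝ} (hz : ‖z‖ = r) (hw : ‖w‖ = r) (h : ‖z + w‖ = 2 * r) :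
    z = w := by
  have := parallelogram_law_with_norm ℝ z w
  rw [hz, hw, h] at this
  have h0 : ‖z - w‖ = 0 := by nlinarith [norm_nonneg (z - w)]
  exact sub_eq_zero.1 (norm_eq_zero.1 h0)

/-- Equality in the triangle inequality forces xy = 2z and xz = 2y, whence x² = 4 and y² + z² = xyz.
-/
theorem markoff_eq_four {p : ℂ × ℂ × ℂ} (hx : ‖p.1‖ = 2) (hy : ‖p.2.1‖ = 2) (hz : ‖p.2.2‖ = 2)
    (hb : ‖p.1 * p.2.1 - p.2.2‖ = 2) (hr : ‖p.1 * p.2.2 - p.2.1‖ = 2) : markoff p = 4 := by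
  have e1 : p.1 * p.2.1 - p.2.2 = p.2.2 :=
    eq_of_norm_add hb hz (by rw [sub_add_cancel, norm_mul, hx, hy])
  have e2 : p.1 * p.2.2 - p.2.1 = p.2.1 :=
    eq_of_norm_add hr hy (by rw [sub_add_cancel, norm_mul, hx, hz])
  have hy0 : p.2.1 ≠ 0 := norm_ne_zero_iff.1 (by rw [hy]; norm_num)
  have e3 : p.1 ^ 2 = 4 := by
    have : p.2.1 * (p.1 ^ 2 - 4) = 0 := by linear_combination p.1 * e1 + 2 * e2
    rcases mul_eq_zero.1 this with h | h
    · exact absurd h hy0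
    · linear_combination h
  simp only [markoff]
  linear_combination e3 - (p.2.1 / 2) * e2 - (p.2.2 / 2) * e1

/-- There is no infinite descending path, except for reducible representations. -/
theorem not_descending {μ : ℂ} (hμ : μ ≠ 4) {p : ℕ → ℂ × ℂ × ℂ} {d : ℕ → Bool}
    (hstep : ∀ i, p (i + 1) = step (d i) (p i)) (hp : ∀ i, markoff (p i) = μ)
    (hd : ∀ b, ∃ᶠ i in atTop, d i = b)
    (h2 : ∀ i, 2 < ‖(p i).1‖ ∧ 2 < ‖(p i).2.1‖)
    (hdesc : ∀ i, ‖(p i).2.2‖ ≤ ‖(p i).1 * (p i).2.1 - (p i).2.2‖) : False := by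
  -- This is the modulus of the coordinate discarded by the move arriving at `p i`; it is what
  -- decreases along the path.
  set β : ℕ → ℝ := fun i => ‖(p i).1 * (p i).2.1 - (p i).2.2‖ with hβ
  have hmulβ : ∀ i, ‖(p i).1‖ * ‖(p i).2.1‖ ≤ 2 * β i := by
    intro i
    have e : ‖(p i).1 * (p i).2.1‖ ≤ ‖(p i).1 * (p i).2.1 - (p i).2.2‖ + ‖(p i).2.2‖ := by
      simpa using norm_add_le ((p i).1 * (p i).2.1 - (p i).2.2) (p i).2.2
    rw [norm_mul] at e
    have := hdesc i
    simp only [hβ]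
    linarith
  have hxβ : ∀ i, ‖(p i).1‖ ≤ β i := fun i => by nlinarith [hmulβ i, h2 i]
  have hyβ : ∀ i, ‖(p i).2.1‖ ≤ β i := fun i => by nlinarith [hmulβ i, h2 i]
  have hβt : ∀ i, d i = true → β (i + 1) = ‖(p i).2.1‖ := by
    intro i hi
    simp only [hβ, hstep i, hi, step, if_true, sub_sub_cancel]
  have hβf : ∀ i, d i = false → β (i + 1) = ‖(p i).1‖ := by
    intro i hi
    simp only [hβ, hstep i, hi, step, if_false, sub_sub_cancel, Bool.false_eq_true]
  have hanti : Antitone β := by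
    refine antitone_nat_of_succ_le fun i => ?_
    cases hi : d i
    · rw [hβf i hi]; exact hxβ i
    · rw [hβt i hi]; exact hyβ i
  have hbdd : BddBelow (Set.range β) := ⟨0, by rintro _ ⟨i, rfl⟩; exact norm_nonneg _⟩
  set L := ⨅ i, β i with hL
  have hlim : Tendsto β atTop (𝓝 L) := tendsto_atTop_ciInf hanti hbdd
  have hLβ : ∀ i, L ≤ β i := fun i => ciInf_le hbdd i
  -- The first coordinate persists until the next `false` move, which discards it and makes its
  -- modulus a value of β.
  have hLx : ∀ i, L ≤ ‖(p i).1‖ := by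
    intro i
    have : ∀ k i, d (i + k) = false → L ≤ ‖(p i).1‖ := by
      intro k
      induction k with
      | zero => intro i hi; rw [← hβf i hi]; exact hLβ _
      | succ k ih =>
        intro i hi
        cases hdi : d i
        · rw [← hβf i hdi]; exact hLβ _
        · have h1 : (p i).1 = (p (i + 1)).1 := by rw [hstep i, hdi]; rfl
          rw [h1]
          exact ih _ (by rw [← hi]; congr 1; omega)
    obtain ⟨j, hij, hj⟩ := (hd false).forall_exists_of_atTop i
    exact this (j - i) i (by rw [Nat.add_sub_cancel' hij]; exact hj)
  have hLy : ∀ i, L ≤ ‖(p i).2.1‖ := by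
    intro i
    have : ∀ k i, d (i + k) = true → L ≤ ‖(p i).2.1‖ := by
      intro k
      induction k with
      | zero => intro i hi; rw [← hβt i hi]; exact hLβ _
      | succ k ih =>
        intro i hi
        cases hdi : d i
        · have h1 : (p i).2.1 = (p (i + 1)).2.1 := by rw [hstep i, hdi]; rfl
          rw [h1]
          exact ih _ (by rw [← hi]; congr 1; omega)
        · rw [← hβt i hdi]; exact hLβ _
    obtain ⟨j, hij, hj⟩ := (hd true).forall_exists_of_atTop i
    exact this (j - i) i (by rw [Nat.add_sub_cancel' hij]; exact hj)
  have hLz : ∀ i, L ≤ ‖(p i).2.2‖ := by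
    intro i
    cases hdi : d i
    · have h1 : (p i).2.2 = (p (i + 1)).1 := by rw [hstep i, hdi]; rfl
      rw [h1]; exact hLx _
    · have h1 : (p i).2.2 = (p (i + 1)).2.1 := by rw [hstep i, hdi]; rfl
      rw [h1]; exact hLy _
  have hx : Tendsto (fun i => ‖(p i).1‖) atTop (𝓝 L) :=
    tendsto_of_tendsto_of_tendsto_of_le_of_le tendsto_const_nhds hlim hLx hxβ
  have hy : Tendsto (fun i => ‖(p i).2.1‖) atTop (𝓝 L) :=
    tendsto_of_tendsto_of_tendsto_of_le_of_le tendsto_const_nhds hlim hLy hyβ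
  have hz : Tendsto (fun i => ‖(p i).2.2‖) atTop (𝓝 L) :=
    tendsto_of_tendsto_of_tendsto_of_le_of_le tendsto_const_nhds hlim hLz hdesc
  have hL2 : L = 2 := by
    have h1 : 2 ≤ L := ge_of_tendsto' hx fun i => (h2 i).1.le
    have h3 : L * L ≤ 2 * L := le_of_tendsto_of_tendsto' (hx.mul hy) (hlim.const_mul 2) hmulβ
    nlinarith
  have hB : 0 ≤ β 0 := norm_nonneg _
  have hmem : ∀ i, p i ∈ Metric.closedBall (0 : ℂ × ℂ × ℂ) (β 0) := by
    intro i
    rw [mem_closedBall_zero_iff, Prod.norm_def, Prod.norm_def]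
    have := hanti (Nat.zero_le i)
    exact max_le ((hxβ i).trans this) (max_le ((hyβ i).trans this) ((hdesc i).trans this))
  obtain ⟨q, -, φ, hφ, hq⟩ := (isCompact_closedBall (0 : ℂ × ℂ × ℂ) (β 0)).tendsto_subseq hmem
  have lim : ∀ f : ℂ × ℂ × ℂ → ℝ, Continuous f → Tendsto (fun i => f (p i)) atTop (𝓝 L) →
      f q = 2 := by
    intro f hf h
    rw [← hL2]
    exact tendsto_nhds_unique ((hf.tendsto q).comp hq) (h.comp hφ.tendsto_atTop)
  have q1 := lim (fun p => ‖p.1‖) (by fun_prop) hx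
  have q2 := lim (fun p => ‖p.2.1‖) (by fun_prop) hy
  have q3 := lim (fun p => ‖p.2.2‖) (by fun_prop) hz
  have q4 := lim (fun p => ‖p.1 * p.2.1 - p.2.2‖) (by fun_prop) hlim
  -- One of the two forward neighbours of the limit also has modulus 2. Which one depends on the
  -- move, which may vary along the subsequence, so the product of the two defects is passed to the
  -- limit.
  have q5 : (‖q.1 * q.2.2 - q.2.1‖ - 2) * (‖q.2.2 * q.2.1 - q.1‖ - 2) = 0 := by
    set f : ℂ × ℂ × ℂ → ℝ :=
      fun p => (‖p.1 * p.2.2 - p.2.1‖ - 2) * (‖p.2.2 * p.2.1 - p.1‖ - 2) with hf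
    have hfc : Continuous f := by fun_prop
    have hbound : ∀ i, ‖f (p i)‖ ≤ |‖(p (i + 1)).2.2‖ - 2| * (β 0 * β 0 + β 0 + 2) := by
      have hest : ∀ u v w : ℂ, ‖u‖ ≤ β 0 → ‖v‖ ≤ β 0 → ‖w‖ ≤ β 0 →
          |‖u * v - w‖ - 2| ≤ β 0 * β 0 + β 0 + 2 := by
        intro u v w hu hv hw
        have h1 : ‖u * v - w‖ ≤ β 0 * β 0 + β 0 :=
          (norm_sub_le _ _).trans (by rw [norm_mul]; gcongr)
        have h0 := norm_nonneg (u * v - w)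
        rw [abs_le]
        constructor <;> nlinarith
      intro i
      have hi := hanti (Nat.zero_le i)
      have b1 := (hxβ i).trans hi
      have b2 := (hyβ i).trans hi
      have b3 := (hdesc i).trans hi
      simp only [hf, norm_mul, Real.norm_eq_abs]
      cases hdi : d i
      · have e : (p (i + 1)).2.2 = (p i).2.2 * (p i).2.1 - (p i).1 := by rw [hstep i, hdi]; rfl
        rw [e, mul_comm]
        gcongr
        exact hest _ _ _ b1 b3 b2
      · have e : (p (i + 1)).2.2 = (p i).1 * (p i).2.2 - (p i).2.1 := by rw [hstep i, hdi]; rfl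
        rw [e]
        gcongr
        exact hest _ _ _ b3 b2 b1
    have h0 : Tendsto (fun i => |‖(p (i + 1)).2.2‖ - 2| * (β 0 * β 0 + β 0 + 2)) atTop (𝓝 0) := by
      have h1 := ((hz.comp (tendsto_add_atTop_nat 1)).sub_const 2).abs
      rw [hL2, sub_self, abs_zero] at h1
      simpa using h1.mul_const (β 0 * β 0 + β 0 + 2)
    exact tendsto_nhds_unique ((hfc.tendsto q).comp hq)
      ((squeeze_zero_norm hbound h0).comp hφ.tendsto_atTop)
  have qμ : markoff q = μ := by
    have hc : Continuous markoff := by unfold markoff; fun_prop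
    refine tendsto_nhds_unique ((hc.tendsto q).comp hq) ?_
    simp only [Function.comp_def, hp]
    exact tendsto_const_nhds
  apply hμ
  rw [← qμ]
  rcases mul_eq_zero.1 q5 with h | h
  · exact markoff_eq_four q1 q2 q3 q4 (by linarith)
  · rw [← markoff_swapCoords]
    refine markoff_eq_four q2 q1 q3 ?_ ?_
    · simp only [swapCoords]; rw [mul_comm]; exact q4
    · simp only [swapCoords]; rw [mul_comm q.2.1]; linarith

/-! ### Local finiteness of the set of small triples -/

/-- Near `p₀`, all but finitely many of the triples beyond the word `w` are large. -/
def Escapes (M : ℝ) (μ : ℂ) (p₀ : ℂ × ℂ × ℂ) (w : List Bool) : Prop :=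
  ∃ S : Set (List Bool), S.Finite ∧
    ∀ᶠ p in 𝓝 p₀, markoff p = μ → ∀ v, v ∉ S → M < height (walk (w ++ v) p)

/-- The BQ-conditions for a triple, along the words in the two moves. -/
structure BowditchPoint (p : ℂ × ℂ × ℂ) : Prop where
  not_elliptic : ∀ w, (walk w p).1 ∉ ellipticTraces ∧ (walk w p).2.1 ∉ ellipticTraces
  sq_ne : ∀ w, (walk w p).1 ^ 2 ≠ markoff p ∧ (walk w p).2.1 ^ 2 ≠ markoff p
  finite_small : ∀ d : ℕ → Bool, {i | ‖(walk ((List.range i).map d) p).2.2‖ ≤ 2}.Finite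

theorem Escapes.of_children {M : ℝ} {μ : ℂ} {p₀ : ℂ × ℂ × ℂ} {w : List Bool}
    (h : ∀ d, Escapes M μ p₀ (w ++ [d])) : Escapes M μ p₀ w := by
  choose S hS hS' using h
  refine ⟨{[]} ∪ (List.cons true '' S true ∪ List.cons false '' S false),
    (Set.finite_singleton _).union (((hS _).image _).union ((hS _).image _)), ?_⟩
  filter_upwards [hS' true, hS' false] with p h1 h2 hp v hv
  match v with
  | [] => exact absurd (Or.inl rfl) hv
  | true :: v =>
    have := h1 hp v fun h => hv (Or.inr (Or.inl ⟨v, h, rfl⟩))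
    rwa [List.append_assoc] at this
  | false :: v =>
    have := h2 hp v fun h => hv (Or.inr (Or.inr ⟨v, h, rfl⟩))
    rwa [List.append_assoc] at this

/-- Being ascending with a kept coordinate above M is an open condition on the triple, and it
controls the whole subtree. -/
theorem Escapes.of_ascending {M : ℝ} {μ : ℂ} {p₀ : ℂ × ℂ × ℂ} {w : List Bool}
    (h : Ascending (walk w p₀)) (hM : M < ‖(walk w p₀).1‖ ∨ M < ‖(walk w p₀).2.1‖) :
    Escapes M μ p₀ w := by
  refine ⟨∅, Set.finite_empty, ?_⟩
  have hopen : IsOpen {p : ℂ × ℂ × ℂ | Ascending p ∧ (M < ‖p.1‖ ∨ M < ‖p.2.1‖)} := by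
    have hor : IsOpen ({p : ℂ × ℂ × ℂ | M < ‖p.1‖} ∪ {p | M < ‖p.2.1‖}) :=
      (isOpen_lt (by fun_prop) (by fun_prop)).union (isOpen_lt (by fun_prop) (by fun_prop))
    refine IsOpen.and (IsOpen.and ?_ (IsOpen.and ?_ ?_)) hor <;>
      exact isOpen_lt (by fun_prop) (by fun_prop)
  filter_upwards [(continuous_walk w).continuousAt.eventually (hopen.mem_nhds ⟨h, hM⟩)]
    with p hp _ v _
  rw [walk_append]
  exact hp.1.lt_height hp.2 v

/-- Sufficiently far along a region, everything is large. -/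
theorem exists_replicate_lt_height (M : ℝ) {μ : ℂ} {p₀ : ℂ × ℂ × ℂ} (hx : p₀.1 ∉ ellipticTraces)
    (hμ : p₀.1 ^ 2 ≠ μ) :
    ∃ N, ∀ᶠ p in 𝓝 p₀, markoff p = μ → ∀ v,
      M < height (walk (List.replicate N true ++ v) p) := by
  -- The constant puts |y| and |z| above M, above 2 and above |x| + 2, so that |z||y| - |x| > |x|
  -- when the path leaves the region.
  obtain ⟨N, hN⟩ := eventually_growth hx hμ (|M| + ‖p₀.1‖ + 3)
  refine ⟨N, ?_⟩
  have c : ∀ᶠ p : ℂ × ℂ × ℂ in 𝓝 p₀, ‖p.1‖ < ‖p₀.1‖ + 1 :=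
    (by fun_prop : Continuous fun p : ℂ × ℂ × ℂ => ‖p.1‖).continuousAt.eventually_lt_const
      (by linarith)
  filter_upwards [hN, c] with p hp h1 hpμ v
  have hM := le_abs_self M
  have h0 := norm_nonneg p₀.1
  have hM0 := abs_nonneg M
  -- A leading `true` only lengthens the run around the region; the first `false` leaves it at an
  -- ascending triple.
  have key : ∀ v : List Bool, ∀ n, N ≤ n → M < height (walk (List.replicate n true ++ v) p) := by
    intro v
    induction v with
    | nil =>
      intro n hn
      rw [List.append_nil]
      exact (show M < _ by linarith [hp hpμ n hn]).trans_le
        ((le_max_left _ _).trans (le_max_right _ _))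
    | cons d v ih =>
      intro n hn
      cases d with
      | true =>
        have := ih (n + 1) (by omega)
        rwa [List.replicate_succ', List.append_assoc] at this
      | false =>
        rw [walk_append, walk_cons]
        have hy := hp hpμ n hn
        have hz := hp hpμ (n + 1) (by omega)
        have hfst := walk_replicate_true_fst n p
        rw [List.replicate_succ', walk_concat] at hz
        change _ < ‖(walk (List.replicate n true) p).2.2‖ at hz
        set q := walk (List.replicate n true) p
        refine Ascending.lt_height ⟨?_, ?_, ?_⟩ (Or.inl ?_) v
        · change 2 < ‖q.2.2‖
          linarith
        · change 2 < ‖q.2.1‖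
          linarith
        · change ‖q.2.2 * q.2.1 - (q.2.2 * q.2.1 - q.1)‖ < ‖q.2.2 * q.2.1 - q.1‖
          rw [sub_sub_cancel]
          have e := norm_sub_norm_le (q.2.2 * q.2.1) q.1
          rw [norm_mul] at e
          rw [hfst] at e ⊢
          nlinarith
        · change M < ‖q.2.2‖
          linarith
  exact key v N le_rfl

theorem BowditchPoint.exists_escapes_replicate {p₀ : ℂ × ℂ × ℂ} (h : BowditchPoint p₀) (M : ℝ)
    (w : List Bool) (d : Bool) :
    ∃ N, Escapes M (markoff p₀) p₀ (w ++ List.replicate N d) := by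
  have hc := (continuous_walk w).continuousAt (x := p₀)
  cases d with
  | true =>
    obtain ⟨N, hN⟩ := exists_replicate_lt_height M (h.not_elliptic w).1 (h.sq_ne w).1
    refine ⟨N, ∅, Set.finite_empty, ?_⟩
    filter_upwards [hc.eventually hN] with p hp hpμ v _
    rw [List.append_assoc, walk_append]
    exact hp (by rw [markoff_walk, hpμ]) v
  | false =>
    obtain ⟨N, hN⟩ := exists_replicate_lt_height M (p₀ := swapCoords (walk w p₀))
      (h.not_elliptic w).2 (h.sq_ne w).2
    refine ⟨N, ∅, Set.finite_empty, ?_⟩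
    filter_upwards [hc.eventually (continuous_swapCoords.continuousAt.eventually hN)]
      with p hp hpμ v _
    have := hp (by rw [markoff_swapCoords, markoff_walk, hpμ]) (v.map not)
    rw [walk_swapCoords, height_swapCoords] at this
    rw [List.append_assoc, walk_append]
    simpa [Function.comp_def] using this

/-- An infinite path in the tree meets an escaping vertex. -/
theorem BowditchPoint.exists_escapes_of_path {p₀ : ℂ × ℂ × ℂ} (h : BowditchPoint p₀)
    (h4 : markoff p₀ ≠ 4) (M : ℝ) (d : ℕ → Bool) :
    ∃ i, Escapes M (markoff p₀) p₀ ((List.range i).map d) := by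
  set p : ℕ → ℂ × ℂ × ℂ := fun i => walk ((List.range i).map d) p₀ with hpdef
  have hstep : ∀ i, p (i + 1) = step (d i) (p i) := by
    intro i
    simp only [hpdef, List.range_succ, List.map_append, List.map_singleton, walk_concat]
  by_cases hd : ∀ b, ∃ᶠ i in atTop, d i = b
  · obtain ⟨I, hI⟩ := (h.finite_small d).bddAbove
    have hz : ∀ i, I < i → 2 < ‖(p i).2.2‖ := fun i hi =>
      not_le.1 fun hle => absurd (hI hle) (not_le.2 hi)
    obtain ⟨J, hIJ, hJ⟩ := (hd true).forall_exists_of_atTop (I + 1)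
    obtain ⟨K, hIK, hK⟩ := (hd false).forall_exists_of_atTop (I + 1)
    -- A `true` move replaces the second coordinate by the third, which is already larger than 2
    -- after time I.
    have hy : ∀ i, J < i → 2 < ‖(p i).2.1‖ := by
      intro i hi
      induction i, hi using Nat.le_induction with
      | base => rw [hstep, hJ]; exact hz J (by omega)
      | succ i hi ih =>
        rw [hstep]
        cases d i
        · exact ih
        · exact hz i (by omega)
    have hx : ∀ i, K < i → 2 < ‖(p i).1‖ := by
      intro i hi
      induction i, hi using Nat.le_induction with
      | base => rw [hstep, hK]; exact hz K (by omega)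
      | succ i hi ih =>
        rw [hstep]
        cases d i
        · exact hz i (by omega)
        · exact ih
    set T := J + K + 1 with hT
    by_cases hasc : ∃ i, T ≤ i ∧ Ascending (p i)
    · obtain ⟨i, hi, hia⟩ := hasc
      obtain ⟨j, hj, hjM⟩ := Ascending.exists_lt (p := fun j => p (i + j)) (d := fun j => d (i + j))
        (fun j => hstep (i + j)) hia M
      exact ⟨i + j, Escapes.of_ascending hj hjM⟩
    · exfalso
      refine not_descending h4 (p := fun j => p (T + j)) (d := fun j => d (T + j))
        (fun j => hstep (T + j)) (fun j => markoff_walk _ _) ?_ ?_ ?_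
      · intro b
        rw [frequently_atTop]
        intro m
        obtain ⟨k, hk, hkb⟩ := (hd b).forall_exists_of_atTop (T + m)
        exact ⟨k - T, by omega, by rw [Nat.add_sub_cancel' (by omega)]; exact hkb⟩
      · exact fun j => ⟨hx _ (by omega), hy _ (by omega)⟩
      · intro j
        by_contra hlt
        exact hasc ⟨T + j, by omega, hx _ (by omega), hy _ (by omega), not_le.1 hlt⟩
  · push Not at hd
    obtain ⟨b, hb⟩ := hd
    obtain ⟨I, hI⟩ := eventually_atTop.1 hb
    obtain ⟨N, hN⟩ := h.exists_escapes_replicate M ((List.range I).map d) (!b)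
    refine ⟨I + N, ?_⟩
    have e : (List.range (I + N)).map d = (List.range I).map d ++ List.replicate N (!b) := by
      rw [List.range_add, List.map_append, List.map_map]
      congr 1
      refine List.eq_replicate_iff.2 ⟨by simp, fun c hc => ?_⟩
      obtain ⟨k, -, rfl⟩ := List.mem_map.1 hc
      exact Bool.eq_not_of_ne (hI _ (Nat.le_add_right _ _))
    rw [e]
    exact hN

/-- König's lemma: a vertex that does not escape has a child that does not, so failure at the root
produces an infinite path without escaping vertices. -/
theorem BowditchPoint.escapes {p₀ : ℂ × ℂ × ℂ} (h : BowditchPoint p₀) (h4 : markoff p₀ ≠ 4)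
    (M : ℝ) : Escapes M (markoff p₀) p₀ [] := by
  by_contra h0
  have hchild : ∀ w, ¬ Escapes M (markoff p₀) p₀ w → ∃ d, ¬ Escapes M (markoff p₀) p₀ (w ++ [d]) :=
    fun w hw => by
      by_contra hc
      push Not at hc
      exact hw (Escapes.of_children hc)
  choose! f hf using hchild
  set W : ℕ → List Bool := fun n => Nat.rec [] (fun _ w => w ++ [f w]) n with hW
  have hWn : ∀ n, ¬ Escapes M (markoff p₀) p₀ (W n) := by
    intro n
    induction n with
    | zero => exact h0
    | succ n ih => exact hf _ ih
  have hWd : ∀ n, W n = (List.range n).map fun i => f (W i) := by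
    intro n
    induction n with
    | zero => rfl
    | succ n ih =>
      rw [List.range_succ, List.map_append, ← ih]
      rfl
  obtain ⟨i, hi⟩ := h.exists_escapes_of_path h4 M fun i => f (W i)
  rw [← hWd] at hi
  exact hWn i hi

/-! ### Common prefixes in free groups -/

/-- The inverse of a letter. -/
def bar {α : Type*} (p : α × Bool) : α × Bool := (p.1, !p.2)

theorem mk_bar {α : Type*} (p : α × Bool) : FreeGroup.mk [bar p] = (FreeGroup.mk [p])⁻¹ := rfl

section CommonPrefix

variable {α : Type*} [DecidableEq α]

/-- The length of the longest common prefix of two lists. -/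
def prefixLen {β : Type*} [DecidableEq β] : List β → List β → ℕ
  | x :: l, y :: m => if x = y then prefixLen l m + 1 else 0
  | _, _ => 0

theorem le_prefixLen_iff {β : Type*} [DecidableEq β] (n : ℕ) (l m : List β) :
    n ≤ prefixLen l m ↔ n ≤ l.length ∧ n ≤ m.length ∧ l.take n = m.take n := by
  induction l generalizing m n with
  | nil => cases n <;> simp [prefixLen]
  | cons x l ih =>
    cases m with
    | nil => cases n <;> simp [prefixLen]
    | cons y m =>
      cases n with
      | zero => simp
      | succ n =>
        by_cases h : x = y
        · simp [prefixLen, h, ih]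
        · simp [prefixLen, h]

theorem drop_prefixLen {β : Type*} [DecidableEq β] (l m : List β) :
    ∀ x ∈ (l.drop (prefixLen l m)).head?, ∀ y ∈ (m.drop (prefixLen l m)).head?, x ≠ y := by
  induction l generalizing m with
  | nil => simp
  | cons x l ih =>
    cases m with
    | nil => simp
    | cons y m =>
      by_cases h : x = y
      · simpa [prefixLen, h] using ih m
      · simp [prefixLen, h]

/-- The length of the common prefix of the reduced words of two elements of a free group. -/
def common (x y : FreeGroup α) : ℕ := prefixLen x.toWord y.toWord

theorem le_common_iff (n : ℕ) (x y : FreeGroup α) : n ≤ common x y ↔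
    n ≤ x.norm ∧ n ≤ y.norm ∧ x.toWord.take n = y.toWord.take n :=
  le_prefixLen_iff n _ _

theorem common_comm (x y : FreeGroup α) : common x y = common y x :=
  eq_of_forall_le_iff fun n => by
    rw [le_common_iff, le_common_iff, eq_comm (a := x.toWord.take n)]; tauto

/-- The ultrametric inequality for the Gromov product of the Cayley tree. -/
theorem min_common_le (x y z : FreeGroup α) : min (common x y) (common y z) ≤ common x z := by
  obtain ⟨h1, -, h3⟩ := (le_common_iff _ x y).1 (min_le_left (common x y) (common y z))
  obtain ⟨-, k2, k3⟩ := (le_common_iff _ y z).1 (min_le_right (common x y) (common y z))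
  exact (le_common_iff _ _ _).2 ⟨h1, k2, h3.trans k3⟩

/-- After removal of the common prefix the next letters differ, so nothing more cancels in x⁻¹y. -/
theorem norm_inv_mul_add (x y : FreeGroup α) :
    (x⁻¹ * y).norm + 2 * common x y = x.norm + y.norm := by
  set n := common x y with hn
  obtain ⟨h1, h2, h3⟩ := (le_common_iff n x y).1 le_rfl
  set s := x.toWord.drop n with hs
  set t := y.toWord.drop n with ht
  have hx : x.toWord = x.toWord.take n ++ s := (List.take_append_drop _ _).symm
  have hy : y.toWord = x.toWord.take n ++ t := by rw [h3]; exact (List.take_append_drop _ _).symm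
  have hmul : x⁻¹ * y = FreeGroup.mk (FreeGroup.invRev s ++ t) := by
    conv_lhs => rw [← FreeGroup.mk_toWord (x := x), ← FreeGroup.mk_toWord (x := y), hx, hy]
    rw [← FreeGroup.mul_mk, ← FreeGroup.mul_mk, ← FreeGroup.mul_mk, ← FreeGroup.inv_mk]
    group
  have hsred : FreeGroup.IsReduced (FreeGroup.invRev s) := by
    have : FreeGroup.IsReduced (FreeGroup.invRev x.toWord) := by
      rw [← FreeGroup.toWord_inv]; exact FreeGroup.isReduced_toWord
    rw [hx, FreeGroup.invRev_append] at this
    exact this.infix (List.infix_append' [] _ _)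
  have htred : FreeGroup.IsReduced t :=
    FreeGroup.isReduced_toWord.infix (List.drop_suffix n y.toWord).isInfix
  have hred : FreeGroup.IsReduced (FreeGroup.invRev s ++ t) := by
    refine List.isChain_append.2 ⟨hsred, htred, ?_⟩
    intro u hu v hv huv
    have hne := drop_prefixLen x.toWord y.toWord (u.1, !u.2) ?_ v hv
    · by_contra hc
      apply hne
      refine Prod.ext huv ?_
      change (!u.2) = v.2
      revert hc
      cases u.2 <;> cases v.2 <;> simp
    · have : FreeGroup.invRev s = ((s.map fun g : α × Bool => (g.1, !g.2)).reverse) := rfl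
      rw [this, List.getLast?_reverse, List.head?_map] at hu
      obtain ⟨w, hw, rfl⟩ := Option.mem_map.1 hu
      rw [hs, hn] at hw
      rw [Bool.not_not]
      exact hw
  rw [hmul, FreeGroup.norm, FreeGroup.toWord_mk, hred.reduce_eq, List.length_append,
    FreeGroup.invRev_length, FreeGroup.norm, FreeGroup.norm]
  have e1 : x.toWord.length = n + s.length := by
    rw [hs, List.length_drop]; exact (Nat.add_sub_cancel' h1).symm
  have e2 : y.toWord.length = n + t.length := by
    rw [ht, List.length_drop]; exact (Nat.add_sub_cancel' h2).symm
  omega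

theorem norm_mul_add (x y : FreeGroup α) : (x * y).norm + 2 * common x⁻¹ y = x.norm + y.norm := by
  have := norm_inv_mul_add x⁻¹ y
  rwa [inv_inv, FreeGroup.norm_inv_eq] at this

/-- Write x = c r c⁻¹ with r cyclically reduced and nonempty; then x² = c r r c⁻¹ is reduced, so
exactly c cancels. -/
theorem two_mul_common_inv_lt {x : FreeGroup α} (hx : x ≠ 1) : 2 * common x⁻¹ x < x.norm := by
  have h := norm_mul_add x x
  have h2 := FreeGroup.reduceCyclically.reduce_flatten_replicate_succ
    (FreeGroup.isReduced_toWord (x := x)) 1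
  rw [← FreeGroup.toWord_pow, one_add_one_eq_two, pow_two] at h2
  have h3 := FreeGroup.reduceCyclically.conj_conjugator_reduceCyclically x.toWord
  set c := FreeGroup.reduceCyclically.conjugator x.toWord
  set r := FreeGroup.reduceCyclically x.toWord
  have h4 : (x * x).norm = c.length + (r.length + r.length) + c.length := by
    rw [FreeGroup.norm, h2]
    simp
    omega
  have h5 : x.norm = c.length + r.length + c.length := by
    rw [FreeGroup.norm, ← h3]
    simp
    omega
  have h6 : r.length ≠ 0 := by
    intro h0
    rw [List.length_eq_zero_iff] at h0
    apply hx
    rw [← FreeGroup.mk_toWord (x := x), ← h3, h0, List.append_nil, ← FreeGroup.mul_mk,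
      ← FreeGroup.inv_mk, mul_inv_cancel]
  omega

/-- The local cancellation condition of Nielsen: no letter of a reduced word is swallowed by
its two neighbours. -/
def NielsenReduced (X : α × Bool → FreeGroup α) : Prop :=
  ∀ p m q, p ≠ bar m → q ≠ bar m → common (X p)⁻¹ (X m) + common (X m)⁻¹ (X q) < (X m).norm

/-- Part of each factor survives both of its neighbours, so by the ultrametric inequality a product
shows to the left the same prefix as its first factor alone. The extra term in the length bound is
what the next factor on the left may cancel; it makes the induction close. -/
theorem NielsenReduced.length_add_le {X : α × Bool → FreeGroup α} (hX : NielsenReduced X)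
    (l : List (α × Bool)) (q : α × Bool) (hl : FreeGroup.IsReduced (q :: l)) (m : α × Bool)
    (hm : m ≠ bar q) :
    common (X m)⁻¹ ((q :: l).map X).prod = common (X m)⁻¹ (X q) ∧
    (q :: l).length + common (X m)⁻¹ (X q) ≤ ((q :: l).map X).prod.norm := by
  have hself : ∀ q : α × Bool, q ≠ bar q := fun q h => by
    have := congrArg Prod.snd h
    revert this
    simp [bar]
  induction l generalizing q m with
  | nil =>
    have := hX m q q hm (hself q)
    simp only [List.map_cons, List.map_nil, List.prod_cons, List.prod_nil, mul_one, true_and,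
      List.length_singleton]
    omega
  | cons r l ih =>
    have hqr : q ≠ bar r := by
      rintro rfl
      have := (FreeGroup.isReduced_cons_cons.1 hl).1 rfl
      revert this
      simp [bar]
    have hrq : r ≠ bar q := by
      rintro rfl
      apply hqr
      simp [bar]
    obtain ⟨h1, h2⟩ := ih r (FreeGroup.isReduced_cons_cons.1 hl).2 q hqr
    set W := ((r :: l).map X).prod with hW
    have hprod : ((q :: r :: l).map X).prod = X q * W := by rw [List.map_cons, List.prod_cons]
    rw [hprod]
    have h3 := norm_mul_add (X q) W
    have h4 := norm_inv_mul_add (X q) (X q * W)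
    rw [inv_mul_cancel_left] at h4
    have h5 := hX m q r hm hrq
    have h6 := min_common_le (X m)⁻¹ (X q) (X q * W)
    have h7 := min_common_le (X m)⁻¹ (X q * W) (X q)
    rw [common_comm (X q * W) (X q)] at h7
    simp only [List.length_cons] at h2 ⊢
    omega

theorem NielsenReduced.length_le {X : α × Bool → FreeGroup α} (hX : NielsenReduced X)
    {l : List (α × Bool)} (hl : FreeGroup.IsReduced l) : l.length ≤ (l.map X).prod.norm := by
  cases l with
  | nil => simp
  | cons q l =>
    have hself : q ≠ bar q := fun h => by
      have := congrArg Prod.snd h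
      revert this
      simp [bar]
    have := (hX.length_add_le l q hl q hself).2
    omega

/-- If `x` cancels to one half against `y` on both sides, then both `x` and `y x` become short
after a suitable conjugation. -/
theorem exists_conj_norm_le {x y : FreeGroup α} {h : ℕ} (hx : x.norm = 2 * h)
    (hy : 2 * h ≤ y.norm) (h1 : h ≤ common y⁻¹ x) (h2 : h ≤ common x⁻¹ y) :
    ∃ c : FreeGroup α, (c⁻¹ * x * c).norm ≤ 2 * h ∧ (c⁻¹ * (y * x) * c).norm ≤ y.norm - 2 * h := by
  obtain ⟨-, -, e1⟩ := (le_common_iff h y⁻¹ x).1 h1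
  obtain ⟨-, -, e2⟩ := (le_common_iff h x⁻¹ y).1 h2
  -- The hypotheses give x = K H⁻¹ and y = H D K⁻¹, so conjugation by H turns x into H⁻¹K and yx
  -- into D.
  set K := x.toWord.take h with hK
  set H := y.toWord.take h with hH
  have hKl : K.length = h := by
    rw [hK, List.length_take]; exact min_eq_left (by change h ≤ x.norm; omega)
  have hHl : H.length = h := by
    rw [hH, List.length_take]; exact min_eq_left (by change h ≤ y.norm; omega)
  have invTake : ∀ (z : FreeGroup α), z⁻¹.toWord.take h =
      FreeGroup.invRev (z.toWord.drop (z.norm - h)) := by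
    intro z
    rw [FreeGroup.toWord_inv, FreeGroup.invRev, FreeGroup.invRev, List.take_reverse, List.map_drop,
      List.length_map]
    rfl
  have hxd : x.toWord.drop h = FreeGroup.invRev H := by
    rw [← e2, invTake, FreeGroup.invRev_invRev, hx]
    congr 1
    omega
  have hyd : y.toWord.drop (y.norm - h) = FreeGroup.invRev K := by
    rw [← e1, invTake, FreeGroup.invRev_invRev]
  have hxw : x = FreeGroup.mk K * (FreeGroup.mk H)⁻¹ := by
    conv_lhs => rw [← FreeGroup.mk_toWord (x := x), ← List.take_append_drop h x.toWord, hxd]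
    rw [← FreeGroup.mul_mk, FreeGroup.inv_mk]
  set D := (y.toWord.take (y.norm - h)).drop h with hD
  have hDl : D.length = y.norm - 2 * h := by
    rw [hD, List.length_drop, List.length_take, FreeGroup.norm] ; omega
  have hyw : y = FreeGroup.mk H * FreeGroup.mk D * (FreeGroup.mk K)⁻¹ := by
    conv_lhs =>
      rw [← FreeGroup.mk_toWord (x := y), ← List.take_append_drop (y.norm - h) y.toWord, hyd,
        ← List.take_append_drop h (y.toWord.take (y.norm - h)), List.take_take,
        min_eq_left (show h ≤ y.norm - h by omega)]
    rw [← FreeGroup.mul_mk, ← FreeGroup.mul_mk, FreeGroup.inv_mk]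
  refine ⟨FreeGroup.mk H, ?_, ?_⟩
  · have e : (FreeGroup.mk H)⁻¹ * x * FreeGroup.mk H = (FreeGroup.mk H)⁻¹ * FreeGroup.mk K := by
      conv_lhs => rw [hxw]
      group
    rw [e]
    refine (FreeGroup.norm_mul_le _ _).trans ?_
    rw [FreeGroup.norm_inv_eq]
    have := FreeGroup.norm_mk_le (L₁ := H)
    have := FreeGroup.norm_mk_le (L₁ := K)
    omega
  · have e : (FreeGroup.mk H)⁻¹ * (y * x) * FreeGroup.mk H = FreeGroup.mk D := by
      conv_lhs => rw [hxw, hyw]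
      group
    rw [e, ← hDl]
    exact FreeGroup.norm_mk_le

end CommonPrefix

/-! ### Nielsen's theorem: generators of the automorphism group -/

theorem mulAut_ext {φ ψ : MulAut Γ} (h1 : φ a = ψ a) (h2 : φ b = ψ b) : φ = ψ := by
  refine MulEquiv.toMonoidHom_injective (FreeGroup.ext_hom _ _ fun i => ?_)
  fin_cases i
  · exact h1
  · exact h2

/-- The endomorphism with given images of `a` and `b`. -/
def endo (u v : Γ) : Γ →* Γ := FreeGroup.lift ![u, v]

@[simp] theorem endo_a (u v : Γ) : endo u v a = u := by simp [endo, a]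

@[simp] theorem endo_b (u v : Γ) : endo u v b = v := by simp [endo, b]

theorem hom_ext {G : Type*} [Group G] {f g : Γ →* G} (h1 : f a = g a) (h2 : f b = g b) : f = g :=
  FreeGroup.ext_hom _ _ fun i => by
    fin_cases i
    · exact h1
    · exact h2

/-- `a ↦ b`, `b ↦ a`. -/
def swapAut : MulAut Γ :=
  (endo b a).toMulEquiv (endo b a) (hom_ext (by simp) (by simp)) (hom_ext (by simp) (by simp))

/-- `a ↦ a`, `b ↦ b⁻¹`. -/
def invAut : MulAut Γ :=
  (endo a b⁻¹).toMulEquiv (endo a b⁻¹) (hom_ext (by simp) (by simp)) (hom_ext (by simp) (by simp))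

/-- `a ↦ a`, `b ↦ a b`. -/
def twistAut : MulAut Γ :=
  (endo a (a * b)).toMulEquiv (endo a (a⁻¹ * b)) (hom_ext (by simp) (by simp))
    (hom_ext (by simp) (by simp))

@[simp] theorem swapAut_a : swapAut a = b := endo_a b a
@[simp] theorem swapAut_b : swapAut b = a := endo_b b a
@[simp] theorem invAut_a : invAut a = a := endo_a a b⁻¹
@[simp] theorem invAut_b : invAut b = b⁻¹ := endo_b a b⁻¹
@[simp] theorem twistAut_a : twistAut a = a := endo_a a (a * b)
@[simp] theorem twistAut_b : twistAut b = a * b := endo_b a (a * b)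

theorem twistAut_inv_a : twistAut⁻¹ a = a := endo_a a (a⁻¹ * b)
theorem twistAut_inv_b : twistAut⁻¹ b = a⁻¹ * b := endo_b a (a⁻¹ * b)

/-- The element of `Γ` represented by a letter. -/
abbrev letter (p : Fin 2 × Bool) : Γ := FreeGroup.mk [p]

/-- All Nielsen moves, for either generator and all signs, are conjugates of `twistAut` or its
inverse by `invAut` and `swapAut`. -/
theorem exists_move {N : Subgroup (MulAut Γ)} (hs : swapAut ∈ N) (hi : invAut ∈ N)
    (ht : twistAut ∈ N) {p q : Fin 2 × Bool} (hpq : p.1 ≠ q.1) :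
    ∃ ψ ∈ N, ψ (letter p) = letter p * letter q ∧ ψ (letter q) = letter q := by
  have hti := N.inv_mem ht
  have la : letter (0, true) = a := rfl
  have la' : letter (0, false) = a⁻¹ := rfl
  have lb : letter (1, true) = b := rfl
  have lb' : letter (1, false) = b⁻¹ := rfl
  have base : ∀ e f : Bool, ∃ ψ ∈ N, ψ (letter (1, e)) = letter (1, e) * letter (0, f) ∧
      ψ (letter (0, f)) = letter (0, f) := by
    intro e f
    cases e <;> cases f
    · exact ⟨twistAut, ht, by simp [lb', la'], by simp [la']⟩
    · exact ⟨twistAut⁻¹, hti, by rw [lb', la, map_inv, twistAut_inv_b]; simp, twistAut_inv_a⟩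
    · exact ⟨invAut * twistAut * invAut, N.mul_mem (N.mul_mem hi ht) hi,
        by simp [lb, la'], by simp [la']⟩
    · refine ⟨invAut * twistAut⁻¹ * invAut, N.mul_mem (N.mul_mem hi hti) hi, ?_, ?_⟩
      · simp only [lb, la, MulAut.mul_apply, invAut_b, map_inv, twistAut_inv_b, map_mul, invAut_a]
        simp
      · simp only [la, MulAut.mul_apply, invAut_a, twistAut_inv_a]
  have sw : ∀ i e, swapAut (letter (i, e)) = letter (1 - i, e) := by
    intro i e
    fin_cases i <;> cases e
    · exact (map_inv swapAut a).trans (by rw [swapAut_a]; rfl)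
    · exact swapAut_a
    · exact (map_inv swapAut b).trans (by rw [swapAut_b]; rfl)
    · exact swapAut_b
  obtain ⟨i, e⟩ := p
  obtain ⟨j, f⟩ := q
  fin_cases i <;> fin_cases j
  · exact absurd rfl hpq
  · obtain ⟨ψ, hψ, h1, h2⟩ := base e f
    refine ⟨swapAut * ψ * swapAut, N.mul_mem (N.mul_mem hs hψ) hs, ?_, ?_⟩
    · change swapAut (ψ (swapAut (letter (0, e)))) = _
      rw [sw, show (1 - 0 : Fin 2) = 1 from rfl, h1, map_mul, sw, sw]
      rfl
    · change swapAut (ψ (swapAut (letter (1, f)))) = _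
      rw [sw, show (1 - 1 : Fin 2) = 0 from rfl, h2, sw]
      rfl
  · exact base e f
  · exact absurd rfl hpq

/-- The total length of the images of the two generators. -/
def totalLen (φ : MulAut Γ) : ℕ := (φ a).norm + (φ b).norm

theorem norm_letter (φ : MulAut Γ) (p : Fin 2 × Bool) :
    (φ (letter p)).norm = (φ (FreeGroup.of p.1)).norm := by
  obtain ⟨i, e⟩ := p
  cases e
  · have : letter (i, false) = (FreeGroup.of i)⁻¹ := rfl
    rw [this, map_inv, FreeGroup.norm_inv_eq]
  · rfl

theorem totalLen_eq (φ : MulAut Γ) {p q : Fin 2 × Bool} (hpq : p.1 ≠ q.1) :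
    totalLen φ = (φ (letter p)).norm + (φ (letter q)).norm := by
  rw [norm_letter, norm_letter]
  obtain ⟨i, e⟩ := p
  obtain ⟨j, f⟩ := q
  fin_cases i <;> fin_cases j
  · exact absurd rfl hpq
  · rfl
  · exact add_comm _ _
  · exact absurd rfl hpq

theorem letter_ne_one (p : Fin 2 × Bool) : letter p ≠ 1 := by
  intro h
  have := congrArg FreeGroup.norm h
  rw [FreeGroup.norm_one] at this
  revert this
  simp [FreeGroup.norm, FreeGroup.toWord_mk]

/-- An automorphism of minimal length in its coset is Nielsen reduced. -/
theorem nielsenReduced_of_minimal {N : Subgroup (MulAut Γ)} (hs : swapAut ∈ N) (hi : invAut ∈ N)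
    (ht : twistAut ∈ N) (hc : ∀ c, MulAut.conj c ∈ N) {φ : MulAut Γ}
    (hφ : ∀ ψ ∈ N, totalLen φ ≤ totalLen (φ * ψ)) :
    NielsenReduced fun p => φ (letter p) := by
  have hne : ∀ p, φ (letter p) ≠ 1 := fun p h =>
    letter_ne_one p (φ.injective (h.trans (map_one φ).symm))
  have hbar : ∀ p, (φ (letter p))⁻¹ = φ (letter (bar p)) := fun p => by
    rw [← map_inv]; rfl
  -- Otherwise replacing p by pq would shorten the pair.
  have hle : ∀ p q : Fin 2 × Bool, p.1 ≠ q.1 →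
      2 * common (φ (letter p))⁻¹ (φ (letter q)) ≤ (φ (letter q)).norm := by
    intro p q hpq
    obtain ⟨ψ, hψ, h1, h2⟩ := exists_move hs hi ht hpq
    have h3 := hφ ψ hψ
    rw [totalLen_eq φ hpq, totalLen_eq (φ * ψ) hpq, MulAut.mul_apply, MulAut.mul_apply, h1, h2,
      map_mul] at h3
    have := norm_mul_add (φ (letter p)) (φ (letter q))
    omega
  have hle' : ∀ p q : Fin 2 × Bool, p.1 ≠ q.1 →
      2 * common (φ (letter p))⁻¹ (φ (letter q)) ≤ (φ (letter p)).norm := by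
    intro p q hpq
    have := hle (bar q) (bar p) hpq.symm
    rw [← hbar, ← hbar, inv_inv, FreeGroup.norm_inv_eq, common_comm] at this
    exact this
  have hself : ∀ m, 2 * common (φ (letter m))⁻¹ (φ (letter m)) < (φ (letter m)).norm :=
    fun m => two_mul_common_inv_lt (hne m)
  have hcases : ∀ p m : Fin 2 × Bool, p ≠ bar m → p.1 = m.1 → p = m := by
    rintro ⟨i, e⟩ ⟨j, f⟩ h (rfl : i = j)
    cases e <;> cases f <;> simp_all [bar]
  intro p m q hp hq
  beta_reduce
  by_cases h1 : p.1 = m.1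
  · obtain rfl := hcases p m hp h1
    have e1 := hself p
    by_cases h2 : q.1 = p.1
    · obtain rfl := hcases q p hq h2
      omega
    · have := hle' p q (Ne.symm h2)
      omega
  · have e1 := hle p m h1
    by_cases h2 : q.1 = m.1
    · obtain rfl := hcases q m hq h2
      have e2 := hself q
      omega
    · have e2 := hle' m q (Ne.symm h2)
      -- Failure means that each side cancels exactly half of the middle factor. If p and q are
      -- inverse letters, the middle factor would cancel half against itself; if they are equal, a
      -- Nielsen move followed by a conjugation shortens the pair. The second case is why N must
      -- contain the inner automorphisms.
      by_contra hlt
      have hpq : p.1 = q.1 := by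
        have := p.1.2; have := q.1.2; have := m.1.2
        rw [Fin.ext_iff] at h1 h2 ⊢
        omega
      by_cases hpq' : p = bar q
      · subst hpq'
        have e3 := hself m
        have e4 := min_common_le (φ (letter m))⁻¹ (φ (letter q)) (φ (letter m))
        rw [← hbar, inv_inv] at e1 hlt
        omega
      · obtain rfl := hcases p q hpq' hpq
        set h := common (φ (letter p))⁻¹ (φ (letter m)) with hh
        have e5 := hle p m h1
        obtain ⟨c, hc1, hc2⟩ := exists_conj_norm_le (x := φ (letter m)) (y := φ (letter p)) (h := h)
          (by omega) (hle' p m h1) le_rfl (by omega)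
        obtain ⟨ψ, hψ, k1, k2⟩ := exists_move hs hi ht h1
        have hmem : MulAut.conj (φ⁻¹ c⁻¹) * ψ ∈ N := N.mul_mem (hc _) hψ
        have hlen := hφ _ hmem
        have hap : ∀ g, (φ * (MulAut.conj (φ⁻¹ c⁻¹) * ψ)) g = c⁻¹ * φ (ψ g) * c := by
          intro g
          simp
        rw [totalLen_eq φ h1, totalLen_eq _ h1, hap, hap, k1, k2, map_mul] at hlen
        have hpos : (φ (letter m)).norm ≠ 0 := fun h0 => hne m (FreeGroup.norm_eq_zero.1 h0)
        have := hle' p m h1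
        omega

theorem prod_letter (l : List (Fin 2 × Bool)) : (l.map letter).prod = FreeGroup.mk l := by
  induction l with
  | nil => rfl
  | cons p l ih =>
    rw [List.map_cons, List.prod_cons, ih, FreeGroup.mul_mk]
    rfl

/-- Such an automorphism sends generators to single letters, hence is one of the eight signed
permutations of the basis. -/
theorem mem_of_norm_le {N : Subgroup (MulAut Γ)} (hs : swapAut ∈ N) (hi : invAut ∈ N)
    {φ : MulAut Γ} (hφ : ∀ g, (φ g).norm ≤ g.norm) : φ ∈ N := by
  have key : ∀ i : Fin 2, ∃ p, φ (FreeGroup.of i) = letter p := by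
    intro i
    have h1 := hφ (FreeGroup.of i)
    rw [FreeGroup.norm_of] at h1
    have h0 : (φ (FreeGroup.of i)).norm ≠ 0 := fun h =>
      FreeGroup.of_ne_one i (φ.injective ((FreeGroup.norm_eq_zero.1 h).trans (map_one φ).symm))
    obtain ⟨p, hp⟩ := List.length_eq_one_iff.1 (show (φ (FreeGroup.of i)).toWord.length = 1 from
      le_antisymm h1 (Nat.one_le_iff_ne_zero.2 h0))
    exact ⟨p, by rw [← FreeGroup.mk_toWord (x := φ (FreeGroup.of i)), hp]⟩
  obtain ⟨⟨i, e⟩, hp⟩ := key 0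
  obtain ⟨⟨j, f⟩, hq⟩ := key 1
  have ha : φ a = letter (i, e) := hp
  have hb : φ b = letter (j, f) := hq
  have hab : a ≠ b := fun h => by
    have := FreeGroup.of_injective h
    exact absurd this (by decide)
  have hab' : a ≠ b⁻¹ := fun h => by
    have := congrArg FreeGroup.toWord h
    revert this
    rw [FreeGroup.toWord_inv]
    simp [a, b, FreeGroup.invRev]
  have hij : i ≠ j := by
    rintro rfl
    by_cases hef : e = f
    · subst hef
      exact hab (φ.injective (ha.trans hb.symm))
    · apply hab'
      apply φ.injective
      rw [ha, map_inv, hb, ← mk_bar]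
      have : e = !f := by revert hef; cases e <;> cases f <;> simp
      rw [this]
      rfl
  have l0 : letter (0, true) = a := rfl
  have l0' : letter (0, false) = a⁻¹ := rfl
  have l1 : letter (1, true) = b := rfl
  have l1' : letter (1, false) = b⁻¹ := rfl
  have hsi := N.mul_mem hs hi
  have his := N.mul_mem hi hs
  fin_cases i <;> fin_cases j
  · exact absurd rfl hij
  · cases e <;> cases f <;> simp only [Fin.zero_eta, Fin.mk_one, l0, l0', l1, l1'] at ha hb
    · rw [mulAut_ext (φ := φ) (ψ := swapAut * invAut * swapAut * invAut) (by simp [ha]) (by simp [hb])]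
      exact N.mul_mem (N.mul_mem hsi hs) hi
    · rw [mulAut_ext (φ := φ) (ψ := swapAut * invAut * swapAut) (by simp [ha]) (by simp [hb])]
      exact N.mul_mem hsi hs
    · rw [mulAut_ext (φ := φ) (ψ := invAut) (by simp [ha]) (by simp [hb])]
      exact hi
    · rw [mulAut_ext (φ := φ) (ψ := 1) (by simp [ha]) (by simp [hb])]
      exact N.one_mem
  · cases e <;> cases f <;> simp only [Fin.zero_eta, Fin.mk_one, l0, l0', l1, l1'] at ha hb
    · rw [mulAut_ext (φ := φ) (ψ := invAut * swapAut * invAut) (by simp [ha]) (by simp [hb])]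
      exact N.mul_mem his hi
    · rw [mulAut_ext (φ := φ) (ψ := invAut * swapAut) (by simp [ha]) (by simp [hb])]
      exact his
    · rw [mulAut_ext (φ := φ) (ψ := swapAut * invAut) (by simp [ha]) (by simp [hb])]
      exact hsi
    · rw [mulAut_ext (φ := φ) (ψ := swapAut) (by simp [ha]) (by simp [hb])]
      exact hs
  · exact absurd rfl hij

/-- Nielsen's theorem: the automorphism group of the free group of rank two is generated by the
inner automorphisms and three elementary automorphisms. -/
theorem eq_top_of_generators_mem {N : Subgroup (MulAut Γ)} (hs : swapAut ∈ N) (hi : invAut ∈ N)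
    (ht : twistAut ∈ N) (hc : ∀ c, MulAut.conj c ∈ N) : N = ⊤ := by
  refine (Subgroup.eq_top_iff' N).2 fun φ => ?_
  induction hn : totalLen φ using Nat.strong_induction_on generalizing φ with
  | _ n ih =>
    by_cases hmin : ∀ ψ ∈ N, totalLen φ ≤ totalLen (φ * ψ)
    · have hred := nielsenReduced_of_minimal hs hi ht hc hmin
      rw [← inv_inv φ]
      refine N.inv_mem (mem_of_norm_le hs hi fun g => ?_)
      -- The reduced word of φ⁻¹(g) writes g in the Nielsen reduced basis, so φ⁻¹ does not increase
      -- length.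
      have h1 := hred.length_le (FreeGroup.isReduced_toWord (x := φ⁻¹ g))
      have h2 : ((φ⁻¹ g).toWord.map fun p => φ (letter p)).prod = g := by
        have : ((φ⁻¹ g).toWord.map fun p => φ (letter p)) =
            ((φ⁻¹ g).toWord.map letter).map φ := by rw [List.map_map]; rfl
        rw [this, ← map_list_prod, prod_letter, FreeGroup.mk_toWord]
        simp
      rw [h2] at h1
      exact h1
    · push Not at hmin
      obtain ⟨ψ, hψ, hlt⟩ := hmin
      exact (Subgroup.mul_mem_cancel_right N hψ).1 (ih _ (hn ▸ hlt) (φ * ψ) rfl)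

/-! ### A normal form for outer automorphisms -/

/-- The relations, modulo inner automorphisms, between the symmetries `s`, `f`, `i` of a superbase
and the flip `n` to an adjacent superbase. -/
structure SuperbaseRelations {G : Type*} [Group G] (s f i n : G) : Prop where
  ss : s * s = 1
  ff : f * f = 1
  ii : i * i = 1
  nn : n * n = 1
  braid : f * s * f = s * f * s
  is : i * s = s * i
  i_f : i * f = f * i
  i_n : i * n = n * i
  sn : s * n = n * (s * i)

namespace SuperbaseRelations

variable {G : Type*} [Group G] {s f i n : G}

/-- The symmetry group of a superbase is finite. -/
theorem finite_closure (h : SuperbaseRelations s f i n) :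
    (Subgroup.closure {s, f, i} : Set G).Finite := by
  -- s and f satisfy the relations of the symmetric group on three letters, and i is a commuting
  -- involution.
  set P : Set G := {1, s, f, s * f, f * s, s * f * s} with hP
  set F : Set G := Set.image2 (fun p q => p * q) P {1, i} with hF
  have hfin : F.Finite := Set.Finite.image2 _ (by simp [hP]) (by simp)
  have hsP : ∀ p ∈ P, s * p ∈ P := by
    rintro p (rfl | rfl | rfl | rfl | rfl | rfl)
    · simp [hP]
    · simp [hP, h.ss]
    · simp [hP]
    · rw [← mul_assoc, h.ss, one_mul]; simp [hP]
    · rw [← mul_assoc]; simp [hP]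
    · rw [← mul_assoc, ← mul_assoc, h.ss, one_mul]; simp [hP]
  have hfP : ∀ p ∈ P, f * p ∈ P := by
    rintro p (rfl | rfl | rfl | rfl | rfl | rfl)
    · simp [hP]
    · simp [hP]
    · simp [hP, h.ff]
    · rw [← mul_assoc, h.braid]; simp [hP]
    · rw [← mul_assoc, h.ff, one_mul]; simp [hP]
    · rw [← h.braid, ← mul_assoc, ← mul_assoc, h.ff, one_mul]; simp [hP]
  have hiP : ∀ p ∈ P, i * p = p * i := by
    have hs : Commute i s := h.is
    have hf : Commute i f := h.i_f
    rintro p (rfl | rfl | rfl | rfl | rfl | rfl)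
    · exact Commute.one_right i
    · exact hs
    · exact hf
    · exact hs.mul_right hf
    · exact hf.mul_right hs
    · exact (hs.mul_right hf).mul_right hs
  have hinv : ∀ x ∈ ({s, f, i} : Set G), x⁻¹ = x := by
    rintro x (rfl | rfl | rfl)
    · exact inv_eq_of_mul_eq_one_left h.ss
    · exact inv_eq_of_mul_eq_one_left h.ff
    · exact inv_eq_of_mul_eq_one_left h.ii
  have hmul : ∀ x ∈ ({s, f, i} : Set G), ∀ y ∈ F, x * y ∈ F := by
    rintro x hx y ⟨p, hp, q, hq, rfl⟩
    change x * (p * q) ∈ F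
    rcases hx with rfl | rfl | rfl
    · exact ⟨x * p, hsP p hp, q, hq, mul_assoc _ _ _⟩
    · exact ⟨x * p, hfP p hp, q, hq, mul_assoc _ _ _⟩
    · refine ⟨p, hp, x * q, ?_, by rw [← mul_assoc x, hiP p hp, mul_assoc]⟩
      rcases hq with rfl | rfl
      · simp
      · simp [h.ii]
  refine hfin.subset fun d hd => ?_
  induction hd using Subgroup.closure_induction_left with
  | one => exact ⟨1, by simp [hP], 1, by simp, mul_one 1⟩
  | mul_left x hx y _ hy => exact hmul x hx y hy
  | inv_mul_cancel x hx y _ hy => rw [hinv x hx]; exact hmul x hx y hy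

/-- The neighbours of a superbase are permuted by its symmetries. -/
theorem mul_flip (h : SuperbaseRelations s f i n) {d : G} (hd : d ∈ Subgroup.closure {s, f, i}) :
    ∃ d' ∈ Subgroup.closure {s, f, i},
      d * n = n * d' ∨ d * n = f * n * d' ∨ d * n = s * (f * n) * s * d' := by
  set D := Subgroup.closure ({s, f, i} : Set G)
  have hs : s ∈ D := Subgroup.subset_closure (by simp)
  have hf : f ∈ D := Subgroup.subset_closure (by simp)
  have hi : i ∈ D := Subgroup.subset_closure (by simp)
  have hinv : ∀ x ∈ ({s, f, i} : Set G), x⁻¹ = x := by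
    rintro x (rfl | rfl | rfl)
    · exact inv_eq_of_mul_eq_one_left h.ss
    · exact inv_eq_of_mul_eq_one_left h.ff
    · exact inv_eq_of_mul_eq_one_left h.ii
  have hmul : ∀ x ∈ ({s, f, i} : Set G), ∀ y,
      (∃ d' ∈ D, y * n = n * d' ∨ y * n = f * n * d' ∨ y * n = s * (f * n) * s * d') →
      ∃ d' ∈ D, x * y * n = n * d' ∨ x * y * n = f * n * d' ∨
        x * y * n = s * (f * n) * s * d' := by
    rintro x hx y ⟨d, hd, hy⟩
    -- On the three cosets, s fixes the first and exchanges the others, f exchanges the first two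
    -- and fixes the third, and i fixes all.
    rcases hx with rfl | rfl | rfl
    · rcases hy with hy | hy | hy
      · refine ⟨x * i * d, D.mul_mem (D.mul_mem hs hi) hd, Or.inl ?_⟩
        rw [mul_assoc, hy, ← mul_assoc, h.sn]
        group
      · refine ⟨x * d, D.mul_mem hs hd, Or.inr (Or.inr ?_)⟩
        rw [mul_assoc, hy]
        calc x * (f * n * d) = x * (f * n) * 1 * d := by group
          _ = x * (f * n) * x * (x * d) := by rw [← h.ss]; group
      · refine ⟨x * d, D.mul_mem hs hd, Or.inr (Or.inl ?_)⟩
        rw [mul_assoc, hy]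
        calc x * (x * (f * n) * x * d) = x * x * (f * n) * x * d := by group
          _ = f * n * (x * d) := by rw [h.ss]; group
    · rcases hy with hy | hy | hy
      · exact ⟨d, hd, Or.inr (Or.inl (by rw [mul_assoc, hy, mul_assoc]))⟩
      · refine ⟨d, hd, Or.inl ?_⟩
        rw [mul_assoc, hy]
        calc x * (x * n * d) = x * x * n * d := by group
          _ = n * d := by rw [h.ff, one_mul]
      · refine ⟨s * i * d, D.mul_mem (D.mul_mem hs hi) hd, Or.inr (Or.inr ?_)⟩
        rw [mul_assoc, hy]
        calc x * (s * (x * n) * s * d) = x * s * x * n * s * d := by group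
          _ = s * x * (s * n) * s * d := by rw [h.braid]; group
          _ = s * x * n * s * (i * s) * d := by rw [h.sn]; group
          _ = s * (x * n) * s * (s * i * d) := by rw [h.is]; group
    · have hc : ∀ z, Commute x z → ∀ d, x * (z * d) = z * (x * d) := fun z hz d => by
        rw [← mul_assoc, hz.eq, mul_assoc]
      have cn : Commute x n := h.i_n
      have cs : Commute x s := h.is
      have cf : Commute x f := h.i_f
      refine ⟨x * d, D.mul_mem hi hd, ?_⟩
      rw [mul_assoc]
      rcases hy with hy | hy | hy <;> rw [hy]
      · exact Or.inl (hc n cn d)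
      · exact Or.inr (Or.inl (hc _ (cf.mul_right cn) d))
      · exact Or.inr (Or.inr (hc _ ((cs.mul_right (cf.mul_right cn)).mul_right cs) d))
  induction hd using Subgroup.closure_induction_left with
  | one => exact ⟨1, D.one_mem, Or.inl (by group)⟩
  | mul_left x hx y _ hy => exact hmul x hx y hy
  | inv_mul_cancel x hx y _ hy => rw [hinv x hx]; exact hmul x hx y hy

/-- Every element generated by the symmetries and the flip is a positive word in the two
elementary moves, up to the flip on the left and a symmetry on the right. -/
theorem exists_normal_form (h : SuperbaseRelations s f i n) {g : G}
    (hg : g ∈ Subgroup.closure {s, f, i, n}) :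
    ∃ (e : Bool) (w : List Bool), ∃ d ∈ Subgroup.closure {s, f, i},
      g = (if e then n else 1) *
        (w.map fun c => if c then f * n else s * (f * n) * s).prod * d := by
  set D := Subgroup.closure ({s, f, i} : Set G) with hD
  have hs : s ∈ D := Subgroup.subset_closure (by simp)
  have hf : f ∈ D := Subgroup.subset_closure (by simp)
  have hi : i ∈ D := Subgroup.subset_closure (by simp)
  set W : List Bool → G := fun w => (w.map fun c => if c then f * n else s * (f * n) * s).prod
  have hWc : ∀ w c, W (w ++ [c]) = W w * if c then f * n else s * (f * n) * s := by
    intro w c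
    simp only [W, List.map_append, List.prod_append, List.map_singleton, List.prod_singleton]
  have hinv : ∀ x ∈ ({s, f, i, n} : Set G), x⁻¹ = x := by
    rintro x (rfl | rfl | rfl | rfl)
    · exact inv_eq_of_mul_eq_one_left h.ss
    · exact inv_eq_of_mul_eq_one_left h.ff
    · exact inv_eq_of_mul_eq_one_left h.ii
    · exact inv_eq_of_mul_eq_one_left h.nn
  have hmulD : ∀ g, (∃ (e : Bool) (w : List Bool), ∃ d ∈ D, g = (if e then n else 1) * W w * d) →
      ∀ x ∈ D, ∃ (e : Bool) (w : List Bool), ∃ d ∈ D, g * x = (if e then n else 1) * W w * d := by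
    rintro g ⟨e, w, d, hd, rfl⟩ x hx
    exact ⟨e, w, d * x, D.mul_mem hd hx, mul_assoc _ _ _⟩
  have hmul : ∀ x ∈ ({s, f, i, n} : Set G), ∀ g,
      (∃ (e : Bool) (w : List Bool), ∃ d ∈ D, g = (if e then n else 1) * W w * d) →
      ∃ (e : Bool) (w : List Bool), ∃ d ∈ D, g * x = (if e then n else 1) * W w * d := by
    rintro x hx g hg
    rcases hx with rfl | rfl | rfl | rfl
    · exact hmulD g hg x hs
    · exact hmulD g hg x hf
    · exact hmulD g hg x hi
    · obtain ⟨e, w, d, hd, rfl⟩ := hg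
      obtain ⟨d', hd', hdd⟩ := h.mul_flip hd
      rcases hdd with hdd | hdd | hdd
      -- This neighbour is the one the path came from: the last letter is deleted because n² = 1,
      -- or, for the empty word, the side of the initial edge changes.
      · rcases List.eq_nil_or_concat w with rfl | ⟨v, c, rfl⟩
        · refine ⟨!e, [], d', hd', ?_⟩
          rw [mul_assoc, hdd]
          cases e
          · simp [W]
          · simp [W, ← mul_assoc, h.nn]
        · rw [List.concat_eq_append, hWc, mul_assoc, hdd]
          cases c with
          | true =>
            refine ⟨e, v, f * d', D.mul_mem hf hd', ?_⟩
            calc (if e then x else 1) * (W v * if true then f * x else s * (f * x) * s) * (x * d')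
                = (if e then x else 1) * (W v * (f * x)) * (x * d') := rfl
              _ = (if e then x else 1) * W v * f * (x * x) * d' := by group
              _ = _ := by rw [h.nn]; group
          | false =>
            refine ⟨e, v, s * f * s * i * d', D.mul_mem (D.mul_mem (D.mul_mem (D.mul_mem hs hf) hs)
              hi) hd', ?_⟩
            calc (if e then x else 1) * (W v * if false then f * x else s * (f * x) * s) * (x * d')
                = (if e then x else 1) * (W v * (s * (f * x) * s)) * (x * d') := rfl
              _ = (if e then x else 1) * W v * s * f * x * (s * x) * d' := by group
              _ = (if e then x else 1) * W v * s * f * (x * x) * s * i * d' := by rw [h.sn]; group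
              _ = _ := by rw [h.nn]; group
      · refine ⟨e, w ++ [true], d', hd', ?_⟩
        rw [hWc, mul_assoc, hdd]
        simp only [if_true, mul_assoc]
      · refine ⟨e, w ++ [false], d', hd', ?_⟩
        rw [hWc, mul_assoc, hdd]
        simp only [Bool.false_eq_true, if_false, mul_assoc]
  induction hg using Subgroup.closure_induction_right with
  | one => exact ⟨false, [], 1, D.one_mem, by simp⟩
  | mul_right g _ x hx hg => exact hmul x hx g hg
  | mul_inv_cancel g _ x hx hg => rw [hinv x hx]; exact hmul x hx g hg

end SuperbaseRelations

/-! ### Outer automorphisms -/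

/-- The inner automorphisms of `Γ`. -/
abbrev innerAut : Subgroup (MulAut Γ) := (MulAut.conj : Γ →* MulAut Γ).range

instance innerAut_normal : innerAut.Normal where
  conj_mem := by
    rintro _ ⟨c, rfl⟩ φ
    exact ⟨φ c, by ext x; simp⟩

/-- The group of outer automorphisms of `Γ`. -/
abbrev OutΓ : Type := MulAut Γ ⧸ innerAut

theorem mk_conj (c : Γ) : ((MulAut.conj c : MulAut Γ) : OutΓ) = 1 :=
  (QuotientGroup.eq_one_iff (N := innerAut) _).2 ⟨c, rfl⟩

theorem out_eq_of_conj {φ ψ : MulAut Γ} (c : Γ) (ha : φ a = c * ψ a * c⁻¹)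
    (hb : φ b = c * ψ b * c⁻¹) : (φ : OutΓ) = ψ := by
  have e : φ = MulAut.conj c * ψ := mulAut_ext (by simp [ha]) (by simp [hb])
  rw [e, QuotientGroup.mk_mul, mk_conj, one_mul]

/-- `a ↦ a`, `b ↦ (a b)⁻¹`. -/
def rotAut : MulAut Γ := twistAut * invAut

/-- `a ↦ a⁻¹`, `b ↦ b⁻¹`, the hyperelliptic involution. -/
def negAut : MulAut Γ := swapAut * invAut * swapAut * invAut

@[simp] theorem rotAut_a : rotAut a = a := by simp [rotAut]
@[simp] theorem rotAut_b : rotAut b = b⁻¹ * a⁻¹ := by simp [rotAut]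
@[simp] theorem negAut_a : negAut a = a⁻¹ := by simp [negAut]
@[simp] theorem negAut_b : negAut b = b⁻¹ := by simp [negAut]

theorem invAut_mul_self : invAut * invAut = 1 := mulAut_ext (by simp) (by simp)

theorem rotAut_mul_invAut : rotAut * invAut = twistAut := by
  rw [rotAut, mul_assoc, invAut_mul_self, mul_one]

/-- Each relation holds on `a` and `b` up to conjugation by the explicit element supplied. -/
theorem superbaseRelations : SuperbaseRelations (swapAut : OutΓ) (rotAut : OutΓ) (negAut : OutΓ)
    (invAut : OutΓ) where
  ss := out_eq_of_conj 1 (by simp) (by simp)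
  ff := out_eq_of_conj (ψ := 1) a (by simp) (by simp)
  ii := out_eq_of_conj 1 (by simp) (by simp)
  nn := out_eq_of_conj 1 (by simp) (by simp)
  braid := out_eq_of_conj (ψ := swapAut * rotAut * swapAut) b⁻¹ (by simp [mul_assoc]) (by simp)
  is := out_eq_of_conj 1 (by simp) (by simp)
  i_f := out_eq_of_conj (φ := negAut * rotAut) (ψ := rotAut * negAut) a⁻¹ (by simp) (by simp)
  i_n := out_eq_of_conj 1 (by simp) (by simp)
  sn := out_eq_of_conj 1 (by simp) (by simp)

/-- The symmetries of the superbase `(a, b, a b)`. -/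
def superbaseSymm : Subgroup OutΓ := Subgroup.closure {(swapAut : OutΓ), ↑rotAut, ↑negAut}

theorem finite_superbaseSymm : (superbaseSymm : Set OutΓ).Finite :=
  superbaseRelations.finite_closure

/-- The change of basis of a word in the two elementary moves. -/
def wordAut (w : List Bool) : MulAut Γ :=
  (w.map fun c => if c then twistAut else swapAut * twistAut * swapAut).prod

/-- The automorphism of a vertex of the tree of superbases: one of the two sides of the edge
between `(a, b, a b)` and `(a, b⁻¹, a b⁻¹)`, and a positive word. -/
def vertexAut (e : Bool) (w : List Bool) : MulAut Γ := (if e then invAut else 1) * wordAut w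

/-- Every automorphism of `Γ` is, up to a symmetry of the superbase and an inner automorphism,
given by a vertex of the tree. -/
theorem exists_vertexAut (φ : MulAut Γ) :
    ∃ e w, (((vertexAut e w)⁻¹ * φ : MulAut Γ) : OutΓ) ∈ superbaseSymm := by
  set S : Subgroup OutΓ := Subgroup.closure {(swapAut : OutΓ), ↑rotAut, ↑negAut, ↑invAut} with hS
  have hi : invAut ∈ S.comap (QuotientGroup.mk' innerAut) := Subgroup.subset_closure (by simp)
  have htop : S.comap (QuotientGroup.mk' innerAut) = ⊤ := by
    refine eq_top_of_generators_mem (Subgroup.subset_closure (by simp)) hi ?_ ?_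
    · rw [← rotAut_mul_invAut]
      exact Subgroup.mul_mem _ (Subgroup.subset_closure (by simp)) hi
    · intro c
      rw [Subgroup.mem_comap, QuotientGroup.mk'_apply, mk_conj]
      exact S.one_mem
  have hφ : (φ : OutΓ) ∈ S := by
    have : φ ∈ S.comap (QuotientGroup.mk' innerAut) := htop ▸ Subgroup.mem_top φ
    exact this
  obtain ⟨e, w, d, hd, h⟩ := superbaseRelations.exists_normal_form hφ
  refine ⟨e, w, ?_⟩
  have hv : ((vertexAut e w : MulAut Γ) : OutΓ) = (if e then (invAut : OutΓ) else 1) *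
      (w.map fun c => if c then (rotAut : OutΓ) * invAut else
        (swapAut : OutΓ) * (rotAut * invAut) * swapAut).prod := by
    rw [vertexAut, QuotientGroup.mk_mul]
    congr 1
    · cases e <;> rfl
    · rw [wordAut]
      change QuotientGroup.mk' innerAut _ = _
      rw [map_list_prod, List.map_map]
      congr 2
      funext c
      cases c
      · change ((swapAut * twistAut * swapAut : MulAut Γ) : OutΓ) = _
        rw [← rotAut_mul_invAut]
        rfl
      · change ((twistAut : MulAut Γ) : OutΓ) = _
        rw [← rotAut_mul_invAut]
        rfl
  rw [QuotientGroup.mk_mul, QuotientGroup.mk_inv, hv, h, inv_mul_cancel_left]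
  exact hd

/-! ### Trace coordinates of representations -/

theorem trace_mul_add_trace_mul_inv (A B : SL2C) :
    Matrix.trace ((A * B : SL2C) : Matrix (Fin 2) (Fin 2) ℂ) +
      Matrix.trace ((A * B⁻¹ : SL2C) : Matrix (Fin 2) (Fin 2) ℂ) =
    Matrix.trace (A : Matrix (Fin 2) (Fin 2) ℂ) * Matrix.trace (B : Matrix (Fin 2) (Fin 2) ℂ) := by
  simp only [Matrix.SpecialLinearGroup.coe_mul, Matrix.SpecialLinearGroup.coe_inv,
    Matrix.adjugate_fin_two, Matrix.trace_fin_two, Matrix.mul_apply, Fin.sum_univ_two,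
    Matrix.of_apply, Matrix.cons_val', Matrix.cons_val_zero, Matrix.cons_val_one,
    Matrix.cons_val_fin_one]
  ring

theorem tr_mul (ρ : Γ →* SL2C) (g h : Γ) : tr ρ (g * h) = tr ρ g * tr ρ h - tr ρ (g * h⁻¹) := by
  have := trace_mul_add_trace_mul_inv (ρ g) (ρ h)
  rw [← map_inv, ← map_mul, ← map_mul] at this
  exact eq_sub_of_add_eq this

theorem tr_inv (ρ : Γ →* SL2C) (g : Γ) : tr ρ g⁻¹ = tr ρ g := by
  simp only [tr, map_inv, Matrix.SpecialLinearGroup.coe_inv, Matrix.adjugate_fin_two,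
    Matrix.trace_fin_two, Matrix.of_apply, Matrix.cons_val', Matrix.cons_val_zero,
    Matrix.cons_val_one, Matrix.cons_val_fin_one]
  ring

theorem tr_mul_comm (ρ : Γ →* SL2C) (g h : Γ) : tr ρ (g * h) = tr ρ (h * g) :=
  tr_isConj ρ (isConj_iff.2 ⟨h, by group⟩)

/-- The trace coordinates of a representation. -/
def coords (ρ : Γ →* SL2C) : ℂ × ℂ × ℂ := (tr ρ a, tr ρ b, tr ρ (a * b))

/-- Fricke's identity. -/
theorem tr_peripheral (ρ : Γ →* SL2C) : tr ρ peripheral = markoff (coords ρ) - 2 := by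
  have hA := (ρ a).det_coe
  have hB := (ρ b).det_coe
  rw [Matrix.det_fin_two] at hA hB
  simp only [peripheral, tr, markoff, coords, map_mul, map_inv, Matrix.SpecialLinearGroup.coe_mul,
    Matrix.SpecialLinearGroup.coe_inv,
    Matrix.adjugate_fin_two, Matrix.trace_fin_two, Matrix.mul_apply, Fin.sum_univ_two,
    Matrix.of_apply, Matrix.cons_val', Matrix.cons_val_zero, Matrix.cons_val_one,
    Matrix.cons_val_fin_one]
  generalize (ρ a : Matrix (Fin 2) (Fin 2) ℂ) = A at *
  generalize (ρ b : Matrix (Fin 2) (Fin 2) ℂ) = B at *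
  linear_combination (A 0 0 + A 1 1) ^ 2 * hB + (B 0 0 + B 1 1) ^ 2 * hA -
    2 * hA * (B 0 0 * B 1 1 - B 0 1 * B 1 0) - 2 * hB

theorem coords_comp_swapAut (ρ : Γ →* SL2C) :
    coords (ρ.comp swapAut.toMonoidHom) = swapCoords (coords ρ) := by
  change (tr ρ (swapAut a), tr ρ (swapAut b), tr ρ (swapAut (a * b))) = _
  rw [map_mul, swapAut_a, swapAut_b, tr_mul_comm]
  rfl

theorem coords_comp_invAut (ρ : Γ →* SL2C) : coords (ρ.comp invAut.toMonoidHom) =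
    ((coords ρ).1, (coords ρ).2.1, (coords ρ).1 * (coords ρ).2.1 - (coords ρ).2.2) := by
  change (tr ρ (invAut a), tr ρ (invAut b), tr ρ (invAut (a * b))) = _
  rw [map_mul, invAut_a, invAut_b, tr_inv, tr_mul, tr_inv, inv_inv]
  rfl

theorem tr_mul_mul (ρ : Γ →* SL2C) (g h : Γ) :
    tr ρ (g * (g * h)) = tr ρ g * tr ρ (g * h) - tr ρ h := by
  rw [tr_mul]
  congr 1
  rw [← tr_inv ρ h]
  exact tr_isConj ρ (isConj_iff.2 ⟨g⁻¹, by group⟩)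

theorem coords_comp_twistAut (ρ : Γ →* SL2C) :
    coords (ρ.comp twistAut.toMonoidHom) = step true (coords ρ) := by
  change (tr ρ (twistAut a), tr ρ (twistAut b), tr ρ (twistAut (a * b))) = _
  rw [map_mul, twistAut_a, twistAut_b, tr_mul_mul]
  rfl

theorem coords_comp_mul (ρ : Γ →* SL2C) (φ ψ : MulAut Γ) :
    coords (ρ.comp (φ * ψ).toMonoidHom) =
      coords ((ρ.comp φ.toMonoidHom).comp ψ.toMonoidHom) := rfl

/-- Precomposition reverses the order of a product, so the leftmost letter of the word moves the
coordinates first. -/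
theorem coords_comp_wordAut (ρ : Γ →* SL2C) (w : List Bool) :
    coords (ρ.comp (wordAut w).toMonoidHom) = walk w (coords ρ) := by
  induction w generalizing ρ with
  | nil => rfl
  | cons c w ih =>
    have e : wordAut (c :: w) =
        (if c then twistAut else swapAut * twistAut * swapAut) * wordAut w := by
      rw [wordAut, List.map_cons, List.prod_cons]; rfl
    rw [e, coords_comp_mul, ih, walk_cons]
    congr 1
    cases c with
    | true => exact coords_comp_twistAut ρ
    | false =>
      change coords (ρ.comp (swapAut * twistAut * swapAut).toMonoidHom) = _
      rw [coords_comp_mul, coords_comp_swapAut, coords_comp_mul, coords_comp_twistAut,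
        coords_comp_swapAut, step_swapCoords]
      rfl

/-- The symmetries of the superbase preserve the heights. -/
theorem height_comp_of_mem {θ : MulAut Γ} (hθ : (θ : OutΓ) ∈ superbaseSymm) (ρ : Γ →* SL2C) :
    height (coords (ρ.comp θ.toMonoidHom)) = height (coords ρ) := by
  set E : Subgroup (MulAut Γ) :=
    { carrier := {θ | ∀ ρ : Γ →* SL2C, height (coords (ρ.comp θ.toMonoidHom)) = height (coords ρ)}
      one_mem' := fun ρ => rfl
      mul_mem' := fun {φ ψ} hφ hψ ρ => by rw [coords_comp_mul, hψ, hφ]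
      inv_mem' := fun {φ} hφ ρ => by
        rw [← hφ, ← coords_comp_mul, inv_mul_cancel]
        rfl } with hE
  have hmem : ∀ φ : MulAut Γ, (∀ ρ : Γ →* SL2C, height (coords (ρ.comp φ.toMonoidHom)) =
      height (coords ρ)) → φ ∈ E := fun _ h => h
  have hle : superbaseSymm ≤ E.map (QuotientGroup.mk' innerAut) := by
    refine (Subgroup.closure_le _).2 ?_
    rintro x (rfl | rfl | rfl)
    · refine ⟨swapAut, hmem _ fun ρ => ?_, rfl⟩
      rw [coords_comp_swapAut, height_swapCoords]
    · refine ⟨rotAut, hmem _ fun ρ => ?_, rfl⟩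
      have e : coords (ρ.comp rotAut.toMonoidHom) = (tr ρ a, tr ρ (a * b), tr ρ b) := by
        change (tr ρ (rotAut a), tr ρ (rotAut b), tr ρ (rotAut (a * b))) = _
        rw [map_mul, rotAut_a, rotAut_b, ← mul_inv_rev, tr_inv, mul_inv_rev, ← tr_inv ρ b]
        congr 2
        exact tr_isConj ρ (isConj_iff.2 ⟨a⁻¹, by group⟩)
      rw [e]
      simp only [height, coords, max_comm ‖tr ρ (a * b)‖]
    · refine ⟨negAut, hmem _ fun ρ => ?_, rfl⟩
      have e : coords (ρ.comp negAut.toMonoidHom) = coords ρ := by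
        change (tr ρ (negAut a), tr ρ (negAut b), tr ρ (negAut (a * b))) = _
        rw [map_mul, negAut_a, negAut_b, ← mul_inv_rev, tr_inv, tr_inv, tr_inv, tr_mul_comm]
        rfl
      rw [e]
  -- θ differs from a height-preserving ψ by an inner automorphism, which changes no trace.
  obtain ⟨ψ, hψ, hψθ⟩ := hle hθ
  obtain ⟨c, hc⟩ := QuotientGroup.eq.1 hψθ
  have e : θ = ψ * MulAut.conj c := by rw [hc]; group
  rw [e, coords_comp_mul]
  have e2 : coords ((ρ.comp ψ.toMonoidHom).comp (MulAut.conj c : MulAut Γ).toMonoidHom) =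
      coords (ρ.comp ψ.toMonoidHom) := by
    have : ∀ g, tr ((ρ.comp ψ.toMonoidHom).comp (MulAut.conj c : MulAut Γ).toMonoidHom) g =
        tr (ρ.comp ψ.toMonoidHom) g := fun g =>
      (tr_isConj (ρ.comp ψ.toMonoidHom) (isConj_iff.2 ⟨c, rfl⟩)).symm
    simp only [coords, this]
  rw [e2]
  exact hψ ρ

/-! ### Bowditch representations give Bowditch points -/

/-- The total exponent. -/
def degree : Γ →* Multiplicative ℤ := FreeGroup.lift fun _ => Multiplicative.ofAdd 1

/-- The total exponent as an integer. -/
def deg (g : Γ) : ℤ := Multiplicative.toAdd (degree g)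

theorem deg_mul (g h : Γ) : deg (g * h) = deg g + deg h := by simp [deg]

theorem deg_a : deg a = 1 := by simp [deg, degree, a]

theorem deg_b : deg b = 1 := by simp [deg, degree, b]

theorem deg_eq_of_isConj {g h : Γ} (H : IsConj g h) : deg g = deg h := by
  have := (degree.map_isConj H)
  rw [isConj_iff_eq] at this
  rw [deg, deg, this]

/-- This invariant separates the curves met along a path of the tree, so that BQ2 can be applied to
the path. -/
theorem abs_deg_eq {g h : Γ} (H : Curve.mk g = Curve.mk h) : |deg g| = |deg h| := by
  rcases Quotient.exact H with H | H
  · rw [deg_eq_of_isConj H]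
  · rw [deg_eq_of_isConj H, show deg h⁻¹ = -deg h by simp [deg], abs_neg]

theorem wordAut_concat (w : List Bool) (c : Bool) : wordAut (w ++ [c]) =
    wordAut w * if c then twistAut else swapAut * twistAut * swapAut := by
  simp [wordAut]

theorem deg_wordAut_pos (w : List Bool) : 0 < deg (wordAut w a) ∧ 0 < deg (wordAut w b) := by
  induction w using List.reverseRecOn with
  | nil => exact ⟨by rw [show wordAut [] a = a from rfl, deg_a]; norm_num,
      by rw [show wordAut [] b = b from rfl, deg_b]; norm_num⟩
  | append_singleton w c ih =>
    rw [wordAut_concat]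
    cases c <;> simp [deg_mul] <;> omega

theorem mk_mem_simpleCurves {g : Γ} (φ : MulAut Γ) (h : φ a = g) : Curve.mk g ∈ simpleCurves :=
  ⟨g, ⟨φ, h⟩, rfl⟩

theorem IsBQ.finite_small {ρ : Γ →* SL2C} (H : IsBQ ρ) {g : ℕ → Γ}
    (hg : ∀ n, Curve.mk (g n) ∈ simpleCurves) (h0 : ∀ n, 0 ≤ deg (g n))
    (hdeg : StrictMono fun n => deg (g n)) : {n | ‖tr ρ (g n)‖ ≤ 2}.Finite := by
  refine Set.Finite.of_finite_image (f := fun n => Curve.mk (g n)) (H.bq2.subset ?_) ?_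
  · rintro _ ⟨n, hn, rfl⟩
    exact ⟨hg n, g n, rfl, hn⟩
  · intro m _ n _ hmn
    have := abs_deg_eq hmn
    rw [abs_of_nonneg (h0 m), abs_of_nonneg (h0 n)] at this
    exact hdeg.injective this

/-- Equality would make the traces of the curves around the region of `a` tend to 0 in one
direction, giving infinitely many small traces against BQ2. The opposite direction is the same
statement for ρ composed with `invAut`. -/
theorem IsBQ.sq_ne {ρ : Γ →* SL2C} (H : IsBQ ρ) : (coords ρ).1 ^ 2 ≠ markoff (coords ρ) := by
  intro heq
  have key : ∀ ρ : Γ →* SL2C, IsBQ ρ →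
      ¬ Tendsto (fun n => (walk (List.replicate n true) (coords ρ)).2.1) atTop (𝓝 0) := by
    intro ρ H hlim
    set g : ℕ → Γ := fun n => wordAut (List.replicate n true) b with hg
    have hfin : {n | ‖tr ρ (g n)‖ ≤ 2}.Finite := by
      refine H.finite_small (fun n => mk_mem_simpleCurves
        (wordAut (List.replicate n true) * swapAut) (by simp [hg]))
        (fun n => (deg_wordAut_pos _).2.le) (strictMono_nat_of_lt_succ fun n => ?_)
      have h1 := (deg_wordAut_pos (List.replicate n true)).1
      simp only [hg, List.replicate_succ', wordAut_concat]
      simp [deg_mul]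
      exact h1
    have hev : ∀ᶠ n in atTop, ‖tr ρ (g n)‖ ≤ 2 := by
      have hlim' := hlim.norm
      rw [norm_zero] at hlim'
      filter_upwards [hlim'.eventually_lt_const (show (0 : ℝ) < 2 by norm_num)] with n hn
      rw [← coords_comp_wordAut] at hn
      exact hn.le
    obtain ⟨I, hI⟩ := eventually_atTop.1 hev
    exact (Set.Ici_infinite I) (hfin.subset fun n hn => hI n hn)
  have hx : (coords ρ).1 ∉ ellipticTraces := H.bq1 a (mk_mem_simpleCurves 1 rfl)
  rcases tendsto_zero_of_sq_eq hx heq with h | h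
  · exact key ρ H h
  · rw [← coords_comp_invAut] at h
    exact key _ (H.comp invAut) h

theorem IsBQ.bowditchPoint {ρ : Γ →* SL2C} (H : IsBQ ρ) : BowditchPoint (coords ρ) where
  not_elliptic w := by
    rw [← coords_comp_wordAut]
    have H' := H.comp (wordAut w)
    exact ⟨H'.bq1 a (mk_mem_simpleCurves 1 rfl),
      H'.bq1 b (mk_mem_simpleCurves swapAut swapAut_a)⟩
  sq_ne w := by
    rw [← markoff_walk w, ← coords_comp_wordAut]
    have H' := H.comp (wordAut w)
    refine ⟨H'.sq_ne, ?_⟩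
    have h := (H'.comp swapAut).sq_ne
    rw [coords_comp_swapAut, markoff_swapCoords] at h
    exact h
  finite_small d := by
    have key : ∀ i, (walk ((List.range i).map d) (coords ρ)).2.2 =
        tr ρ (wordAut ((List.range i).map d) (a * b)) := by
      intro i
      rw [← coords_comp_wordAut]
      rfl
    simp only [key]
    refine H.finite_small (fun i => mk_mem_simpleCurves
      (wordAut ((List.range i).map d) * (twistAut * swapAut)) (by simp)) (fun i => ?_)
      (strictMono_nat_of_lt_succ fun i => ?_)
    · rw [map_mul, deg_mul]
      have := deg_wordAut_pos ((List.range i).map d)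
      omega
    · have := deg_wordAut_pos ((List.range i).map d)
      rw [List.range_succ, List.map_append, List.map_singleton, wordAut_concat]
      cases d i <;> simp [deg_mul] <;> omega

/-! ### Proper discontinuity -/

theorem markoff_coords {τ : ℂ} (ρ : TauRep τ) : markoff (coords ρ.1) = τ + 2 := by
  have h := (tr_peripheral ρ.1).symm.trans ρ.2
  linear_combination h

/-- The effect of `invAut` on trace coordinates. -/
def invCoords (p : ℂ × ℂ × ℂ) : ℂ × ℂ × ℂ := (p.1, p.2.1, p.1 * p.2.1 - p.2.2)

theorem continuous_invCoords : Continuous invCoords := by unfold invCoords; fun_prop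

theorem continuous_traceCoords (τ : ℂ) : Continuous (traceCoords τ) := continuous_induced_dom

/-- The property that all but the vertices in `F` have height larger than `M`. -/
def LargeOutside {τ : ℂ} (M : ℝ) (F : Set (Bool × List Bool)) (y : XQ τ) : Prop :=
  ∀ ρ : TauRep τ, X.mk ρ = y.1 → ∀ e w, (e, w) ∉ F →
    M < height (coords (ρ.1.comp (vertexAut e w).toMonoidHom))

/-- The tree is rooted at an edge, so `BowditchPoint.escapes` is applied on both sides: at the trace
coordinates and at their flip by `invAut`. -/
theorem eventually_largeOutside {τ : ℂ} (hτ : τ ≠ 2) (M : ℝ) (x : XQ τ) :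
    ∃ F : Set (Bool × List Bool), F.Finite ∧ ∀ᶠ y in 𝓝 x, LargeOutside M F y := by
  obtain ⟨x, hx⟩ := x
  induction x using Quotient.inductionOn with
  | h ρ₀ =>
    have hρ₀ : IsBQ ρ₀.1 := hx
    have h4 : τ + 2 ≠ 4 := fun h => hτ (by linear_combination h)
    have key : ∀ ρ : Γ →* SL2C, IsBQ ρ → markoff (coords ρ) = τ + 2 →
        Escapes M (τ + 2) (coords ρ) [] := by
      intro ρ H h
      have := H.bowditchPoint.escapes (by rw [h]; exact h4) M
      rwa [h] at this
    have hμ : ∀ ρ : TauRep τ, markoff (invCoords (coords ρ.1)) = τ + 2 := by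
      intro ρ
      rw [← markoff_coords ρ]
      simp only [markoff, invCoords]
      ring
    obtain ⟨S, hS, hS'⟩ := key ρ₀.1 hρ₀ (markoff_coords ρ₀)
    obtain ⟨T, hT, hT'⟩ := key _ (hρ₀.comp invAut) (by
      rw [coords_comp_invAut]; exact hμ ρ₀)
    rw [coords_comp_invAut] at hT'
    refine ⟨Prod.mk false '' S ∪ Prod.mk true '' T, (hS.image _).union (hT.image _), ?_⟩
    have hc : ContinuousAt (fun y : XQ τ => traceCoords τ y.1) ⟨Quotient.mk _ ρ₀, hx⟩ :=
      ((continuous_traceCoords τ).comp continuous_subtype_val).continuousAt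
    have hc' := continuous_invCoords.continuousAt.comp hc
    filter_upwards [hc.eventually hS', hc'.eventually hT'] with y h1 h2 ρ hρ e w hew
    have hy : traceCoords τ y.1 = coords ρ.1 := by rw [← hρ]; rfl
    simp only [Function.comp_apply, hy, List.nil_append] at h1 h2
    rw [vertexAut, coords_comp_mul, coords_comp_wordAut]
    cases e with
    | false => exact h1 (markoff_coords ρ) w fun h => hew (Or.inl ⟨w, h, rfl⟩)
    | true =>
      change M < height (walk w (coords (ρ.1.comp invAut.toMonoidHom)))
      rw [coords_comp_invAut]
      exact h2 (hμ ρ) w fun h => hew (Or.inr ⟨w, h, rfl⟩)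

theorem exists_largeOutside {τ : ℂ} (hτ : τ ≠ 2) (M : ℝ) {K : Set (XQ τ)} (hK : IsCompact K) :
    ∃ F : Set (Bool × List Bool), F.Finite ∧ ∀ y ∈ K, LargeOutside M F y := by
  refine hK.induction_on (p := fun s => ∃ F : Set (Bool × List Bool), F.Finite ∧
    ∀ y ∈ s, LargeOutside M F y) ⟨∅, Set.finite_empty, by simp⟩ ?_ ?_ ?_
  · rintro s t hst ⟨F, hF, h⟩
    exact ⟨F, hF, fun y hy => h y (hst hy)⟩
  · rintro s t ⟨F, hF, h⟩ ⟨F', hF', h'⟩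
    refine ⟨F ∪ F', hF.union hF', ?_⟩
    rintro y (hy | hy) ρ hρ e w hew
    · exact h y hy ρ hρ e w fun hc => hew (Or.inl hc)
    · exact h' y hy ρ hρ e w fun hc => hew (Or.inr hc)
  · intro x _
    obtain ⟨F, hF, h⟩ := eventually_largeOutside hτ M x
    exact ⟨_, mem_nhdsWithin_of_mem_nhds h, F, hF, fun y hy => hy⟩

/-- The mapping class group as a subgroup of the outer automorphism group. -/
def toOut : MCG →* OutΓ :=
  QuotientGroup.map inner innerAut puncturedAut.subtype fun _ h => Subgroup.mem_subgroupOf.1 h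

theorem toOut_injective : Function.Injective toOut := by
  refine (injective_iff_map_eq_one _).2 fun H hH => ?_
  induction H using QuotientGroup.induction_on with
  | H φ =>
    refine (QuotientGroup.eq_one_iff φ).2 (Subgroup.mem_subgroupOf.2 ?_)
    exact (QuotientGroup.eq_one_iff (N := innerAut) φ.1).1 hH

theorem height_le_norm (p : ℂ × ℂ × ℂ) : height p ≤ ‖p‖ := le_rfl

theorem finite_setOf_smul_inter {τ : ℂ} (hτ : τ ≠ 2) {K L : Set (XQ τ)} (hK : IsCompact K)
    (hL : IsCompact L) : {H : MCG | ((H • ·) '' K ∩ L).Nonempty}.Finite := by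
  have hcont : Continuous fun y : XQ τ => traceCoords τ y.1 :=
    (continuous_traceCoords τ).comp continuous_subtype_val
  obtain ⟨M, hM⟩ := (hL.image hcont).isBounded.exists_norm_le
  obtain ⟨F, hF, hKF⟩ := exists_largeOutside hτ M hK
  set D : Set OutΓ := Set.image2 (fun v d => ((vertexAut v.1 v.2 : MulAut Γ) : OutΓ) * d) F
    superbaseSymm with hD
  have hDfin : D.Finite := hF.image2 _ finite_superbaseSymm
  -- The inverse appears because [φ] acts by ρ ↦ ρ ∘ φ⁻¹.
  refine (hDfin.preimage (f := fun H : MCG => (toOut H)⁻¹)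
    (inv_injective.comp toOut_injective).injOn).subset ?_
  rintro H ⟨_, ⟨x, hxK, rfl⟩, hxL⟩
  induction H using QuotientGroup.induction_on with
  | H φ =>
    obtain ⟨ρ, hρ⟩ := Quotient.exists_rep x.1
    obtain ⟨e, w, hew⟩ := exists_vertexAut (φ⁻¹).1
    set θ : MulAut Γ := (vertexAut e w)⁻¹ * (φ⁻¹).1 with hθ
    have hφ : (φ⁻¹).1 = vertexAut e w * θ := by rw [hθ, mul_inv_cancel_left]
    refine ⟨(e, w), ?_, θ, hew, ?_⟩
    -- Outside F the height at the vertex of φ⁻¹ exceeds M. The symmetry θ does not change it, yet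
    -- it is the height of a point of L, at most M.
    · by_contra hF'
      have h1 := hKF x hxK ρ hρ e w hF'
      have h2 := hM _ ⟨_, hxL, rfl⟩
      have h3 : traceCoords τ ((QuotientGroup.mk φ : MCG) • x.1) =
          coords (ρ.1.comp (vertexAut e w * θ).toMonoidHom) := by
        rw [← hρ, ← hφ]
        rfl
      have h4 : traceCoords τ ((QuotientGroup.mk φ : MCG) • x).1 =
          coords (ρ.1.comp (vertexAut e w * θ).toMonoidHom) := h3
      have h5 := height_comp_of_mem hew (ρ.1.comp (vertexAut e w).toMonoidHom)
      rw [← coords_comp_mul] at h5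
      have h6 := height_le_norm (coords (ρ.1.comp (vertexAut e w * θ).toMonoidHom))
      simp only [h4] at h2
      linarith
    · change ((vertexAut e w : MulAut Γ) : OutΓ) * (θ : OutΓ) = (toOut (QuotientGroup.mk φ))⁻¹
      rw [← QuotientGroup.mk_mul, ← hφ]
      rfl

end PuncturedTorus

theorem theorem2p3 (τ : ℂ) (hτ : τ ≠ 2) :
    ProperlyDiscontinuousSMul PuncturedTorus.MCG (PuncturedTorus.XQ τ) :=
  ⟨fun hK hL => PuncturedTorus.finite_setOf_smul_inter hτ hK hL⟩
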